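/- There are infinitely many pairwise non-isomorphic finite groups $G$ such that every connected Cayley graph on $G$ has a hamiltonian cycle and $G$ is not solvable. Here, for a subset $S$ of $G$, the Cayley graph $\mathrm{Cay}(G;S)$ is the graph whose vertices are the elements of $G$, with edges joining $g$ to $gs$ and to $gs^{-1}$ for all $g\in G$ and $s\in S$ (loops and repeated edges being ignored); a hamiltonian cycle is a cycle that visits every vertex exactly once. -/

import Mathlib

open Classical in
/-- The graph `Γ` contains a hamiltonian cycle: a cycle that visits every vertex exactly once. -/
def HasHamiltonianCycle {V : Type*} (Γ : SimpleGraph V) : Prop :=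
  ∃ (v : V) (c : Γ.Walk v v), c.IsHamiltonianCycle

/-- Every connected Cayley graph on `G` has a hamiltonian cycle. In `SimpleGraph.mulCayley S`, the
vertices are the elements of `G`, and distinct `g`, `h` are adjacent when `h = g * s` or
`h = g * s⁻¹` for some `s ∈ S`; the connection set `S` is an arbitrary subset of `G`. -/
def ConnectedCayleyGraphsHamiltonian (G : Type*) [Group G] : Prop :=
  ∀ S : Set G, (SimpleGraph.mulCayley S).Connected →
    HasHamiltonianCycle (SimpleGraph.mulCayley S)

/-! The groups are `A × C`, where `A` is the alternating group of degree 5 and `C` has prime order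
`p > 10000` with `p ≡ 1` modulo 3. There are infinitely many such primes, the orders `60 * p` are
distinct, and `A` is a nonsolvable quotient.

A connected Cayley graph comes from a generating set `S`. Up to inverses and an automorphism, the
projection of `S` to `A` contains one of twenty explicit triples, possibly with a repeated entry
(`hasGeneratingTriple_of_closure_eq_top`). Lift the triple to elements of `S` and consider their
components in `C`.

If a hamiltonian word of `A` in these letters lifts to a word whose product has a nontrivial
component in `C`, then repeating the lift `p` times gives a hamiltonian cycle
(`IsHamiltonianWord.of_fst`). That component depends only on exponent sums. For nineteen triples
there are three words whose matrix of exponent sums has nonzero determinant of absolute value below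
10000, hence invertible modulo `p`; so one of them works unless all three lifts lie in `A × 1`
(`exists_prod_ne_one`).

If the letters used lie in `A × 1`, some other `(a, c)` in `S` has `c ≠ 1`. A hamiltonian path is
traversed in each coset of `A`, with `(a, c)` leading to the next one. The choice of the edge
omitted in each coset is enough freedom to close the cycle, because `A` is simple and nonabelian and
`p` is at least the order of `A` (`exists_hamiltonianWord_of_layers`).

The exceptional triple consists of `a` of order 2 and `b` of order 3. Its word has exponent sum 0 in
`b`, so the lifts `(a, 1)` and `(b, c)` with `c ≠ 1` remain. There a closed walk on four layers is
stretched to `p = 4 + 3 * m` layers, using `b ^ 3 = 1` (`StrandStep.isHamiltonianWord_expand`). -/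

/-! ### Closed walks as words in a group -/

/-- The vertices visited by the walk that starts at `g` and follows the steps in `w`,
except for its endpoint. -/
def walkVertices {G : Type*} [Mul G] : G → List G → List G
  | _, [] => []
  | g, x :: w => g :: walkVertices (g * x) w

/-- A word is hamiltonian if the walk it describes is closed and visits every element once. -/
structure IsHamiltonianWord {G : Type*} [Group G] (w : List G) : Prop where
  length_eq : w.length = Nat.card G
  prod_eq : w.prod = 1
  mem_vertices : ∀ g, g ∈ walkVertices 1 w

section WalkVertices

variable {G H : Type*} [Group G] [Group H]

@[simp] theorem walkVertices_nil (g : G) : walkVertices g [] = [] := rfl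

@[simp] theorem walkVertices_cons (g x : G) (w : List G) :
    walkVertices g (x :: w) = g :: walkVertices (g * x) w := rfl

@[simp] theorem length_walkVertices (g : G) (w : List G) :
    (walkVertices g w).length = w.length := by
  induction w generalizing g with
  | nil => rfl
  | cons x w ih => simp [ih]

theorem walkVertices_append (g : G) (u v : List G) :
    walkVertices g (u ++ v) = walkVertices g u ++ walkVertices (g * u.prod) v := by
  induction u generalizing g with
  | nil => simp
  | cons x u ih => simp [ih, mul_assoc]

theorem walkVertices_mul (h g : G) (w : List G) :
    walkVertices (h * g) w = (walkVertices g w).map (h * ·) := by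
  induction w generalizing g with
  | nil => rfl
  | cons x w ih => simp [mul_assoc, ih]

theorem walkVertices_map (f : G →* H) (g : G) (w : List G) :
    walkVertices (f g) (w.map f) = (walkVertices g w).map f := by
  induction w generalizing g with
  | nil => rfl
  | cons x w ih => simp [← map_mul, ih]

theorem mem_walkVertices_mul {h g k : G} {w : List G} :
    k ∈ walkVertices (h * g) w ↔ h⁻¹ * k ∈ walkVertices g w := by
  rw [walkVertices_mul, List.mem_map]
  exact ⟨by rintro ⟨a, ha, rfl⟩; simpa using ha, fun hk => ⟨_, hk, by simp⟩⟩

theorem mem_walkVertices_iff {g k : G} {w : List G} :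
    k ∈ walkVertices g w ↔ g⁻¹ * k ∈ walkVertices 1 w := by
  simpa using mem_walkVertices_mul (h := g) (g := 1) (k := k) (w := w)

theorem mem_walkVertices_one_iff {k : G} {w : List G} :
    k ∈ walkVertices 1 w ↔ ∃ u v, w = u ++ v ∧ v ≠ [] ∧ u.prod = k := by
  constructor
  · induction w generalizing k with
    | nil => simp
    | cons x w ih =>
      intro hk
      rcases List.mem_cons.1 hk with rfl | hk
      · exact ⟨[], x :: w, by simp⟩
      · rw [one_mul, mem_walkVertices_iff] at hk
        obtain ⟨u, v, rfl, hv, hu⟩ := ih hk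
        exact ⟨x :: u, v, rfl, hv, by simp [hu]⟩
  · rintro ⟨u, v, rfl, hv, rfl⟩
    rw [walkVertices_append]
    cases v with
    | nil => exact absurd rfl hv
    | cons x v => simp

theorem exists_walk_of_word {S : Set G} (g : G) (w : List G)
    (hw : ∀ x ∈ w, x ≠ 1 ∧ (x ∈ S ∨ x⁻¹ ∈ S)) :
    ∃ c : (SimpleGraph.mulCayley S).Walk g (g * w.prod),
      c.support = walkVertices g w ++ [g * w.prod] := by
  induction w generalizing g with
  | nil =>
    have key : ∀ h, h = g → ∃ c : (SimpleGraph.mulCayley S).Walk g h,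
        c.support = walkVertices g [] ++ [h] := by
      rintro _ rfl
      exact ⟨SimpleGraph.Walk.nil, by simp⟩
    exact key _ (by simp)
  | cons x w ih =>
    obtain ⟨c, hc⟩ := ih (g * x) fun y hy => hw y (List.mem_cons_of_mem _ hy)
    obtain ⟨hx, hxS⟩ := hw x (by simp)
    have hadj : (SimpleGraph.mulCayley S).Adj g (g * x) := by
      rw [SimpleGraph.mulCayley_adj]
      exact ⟨by simpa using hx, by simpa using hxS⟩
    refine ⟨(SimpleGraph.Walk.cons hadj c).copy rfl (by simp [mul_assoc]), ?_⟩
    simp [hc, mul_assoc]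

end WalkVertices

namespace IsHamiltonianWord

variable {G H : Type*} [Group G] [Group H] {w : List G}

/-- A list as long as the group that contains every element cannot repeat one. -/
theorem nodup [Finite G] (hw : IsHamiltonianWord w) : (walkVertices 1 w).Nodup := by
  classical
  have := Fintype.ofFinite G
  rw [← Multiset.coe_nodup, ← Multiset.toFinset_card_eq_card_iff_nodup]
  have : (walkVertices 1 w : Multiset G).toFinset = Finset.univ := by
    ext g; simpa using hw.mem_vertices g
  rw [this, Finset.card_univ, Multiset.coe_card, length_walkVertices, hw.length_eq,
    Nat.card_eq_fintype_card]

/-- A trivial letter would make two cyclically consecutive vertices equal. -/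
theorem ne_one_of_mem [Finite G] (hw : IsHamiltonianWord w) (hG : 2 ≤ Nat.card G) {x : G}
    (hx : x ∈ w) : x ≠ 1 := by
  rintro rfl
  obtain ⟨u, v, rfl⟩ := List.append_of_mem hx
  have hn := hw.nodup
  have hp := hw.prod_eq
  have hl := hw.length_eq
  rw [walkVertices_append] at hn
  cases v with
  | cons y v => simp [List.nodup_append] at hn
  | nil =>
    cases u with
    | nil => simp at hl; omega
    | cons y u =>
      simp only [List.prod_append, List.prod_cons, List.prod_nil, mul_one] at hp
      simp [hp] at hn

theorem hasHamiltonianCycle [Finite G] (hw : IsHamiltonianWord w) (hG : 3 ≤ Nat.card G)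
    {S : Set G} (hS : ∀ x ∈ w, x ∈ S ∨ x⁻¹ ∈ S) :
    HasHamiltonianCycle (SimpleGraph.mulCayley S) := by
  classical
  have := Fintype.ofFinite G
  obtain ⟨c, hc⟩ := exists_walk_of_word (S := S) 1 w
    fun x hx => ⟨hw.ne_one_of_mem (by omega) hx, hS x hx⟩
  obtain ⟨c, hc⟩ : ∃ c : (SimpleGraph.mulCayley S).Walk 1 1,
      c.support = walkVertices 1 w ++ [1] :=
    ⟨c.copy rfl (by simp [hw.prod_eq]), by simp [hc, hw.prod_eq]⟩
  have hl : c.length = Nat.card G := by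
    have := congrArg List.length hc
    simpa [hw.length_eq] using this
  refine ⟨1, c, ?_⟩
  have hcyc : c.IsCycle := by
    rw [SimpleGraph.Walk.isCycle_iff_isPath_tail_and_le_length]
    refine ⟨?_, by omega⟩
    have hnil : ¬ c.Nil := by
      intro h; rw [← SimpleGraph.Walk.length_eq_zero_iff] at h; omega
    rw [SimpleGraph.Walk.isPath_def, SimpleGraph.Walk.support_tail_of_not_nil _ hnil, hc]
    have hn := hw.nodup
    cases w with
    | nil => simp
    | cons x w =>
      simp only [walkVertices_cons, List.cons_append, List.tail_cons, List.nodup_cons] at hn ⊢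
      -- The support of the tail is the vertex list with the initial 1 moved to the end.
      exact List.nodup_append_comm.1 (by simpa using hn)
  have := SimpleGraph.Walk.isHamiltonianCycle_iff_isCycle_and_length_eq.2
    ⟨hcyc, by rw [hl, Nat.card_eq_fintype_card]⟩
  convert this

theorem map (hw : IsHamiltonianWord w) (f : G ≃* H) : IsHamiltonianWord (w.map f) where
  length_eq := by rw [List.length_map, hw.length_eq, Nat.card_congr f.toEquiv]
  prod_eq := by rw [List.prod_hom, hw.prod_eq, map_one]
  mem_vertices h := by
    have := walkVertices_map f.toMonoidHom 1 w
    simp only [map_one] at this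
    have h2 := List.mem_map_of_mem (f := f) (hw.mem_vertices (f.symm h))
    rw [f.apply_symm_apply] at h2
    exact this ▸ h2

theorem of_nodup [Finite G] (hl : w.length = Nat.card G) (hp : w.prod = 1)
    (hn : (walkVertices 1 w).Nodup) : IsHamiltonianWord w where
  length_eq := hl
  prod_eq := hp
  mem_vertices g := by
    classical
    have := Fintype.ofFinite G
    have : (walkVertices 1 w).toFinset = Finset.univ := by
      rw [← Finset.card_eq_iff_eq_univ, List.toFinset_card_of_nodup hn, length_walkVertices, hl,
        Nat.card_eq_fintype_card]
    rw [← List.mem_toFinset, this]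
    exact Finset.mem_univ g

/-- The hamiltonian word obtained by moving the initial vertex. -/
theorem rotate {u v : List G} (hw : IsHamiltonianWord (u ++ v)) : IsHamiltonianWord (v ++ u) := by
  have hp : u.prod * v.prod = 1 := by simpa using hw.prod_eq
  refine ⟨by rw [← hw.length_eq]; simp [add_comm], ?_, fun g => ?_⟩
  · rw [List.prod_append, mul_eq_one_iff_eq_inv'.1 hp]; simp
  · have h := hw.mem_vertices (u.prod * g)
    rw [walkVertices_append, List.mem_append, one_mul] at h
    rw [walkVertices_append, List.mem_append, one_mul, or_comm]
    rw [mem_walkVertices_iff (g := v.prod), mem_walkVertices_iff (g := u.prod)] at *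
    simp only [eq_inv_of_mul_eq_one_left hp, inv_inv] at h ⊢
    simpa using h

/-- The hamiltonian word that describes the reversed cycle. -/
theorem reverse [Finite G] (hw : IsHamiltonianWord w) :
    IsHamiltonianWord (w.map (·⁻¹)).reverse := by
  refine ⟨by simpa using hw.length_eq, by rw [← List.prod_inv_reverse, hw.prod_eq, inv_one],
    fun g => ?_⟩
  obtain ⟨u, v, rfl, hv, rfl⟩ := mem_walkVertices_one_iff.1 (hw.mem_vertices g)
  rw [mem_walkVertices_one_iff]
  cases u with
  | nil => exact ⟨[], _, rfl, by simpa using hv, rfl⟩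
  | cons x u =>
    refine ⟨(v.map (·⁻¹)).reverse, ((x :: u).map (·⁻¹)).reverse, by simp, by simp, ?_⟩
    rw [← List.prod_inv_reverse, inv_eq_iff_mul_eq_one, ← hw.prod_eq, List.prod_append]
    have := hw.prod_eq
    rw [List.prod_append] at this
    rw [this, mul_eq_one_iff_eq_inv.1 this, mul_inv_cancel]

end IsHamiltonianWord

/-! ### Hamiltonian words in a product with a group of prime order -/

open scoped Pointwise

section FactorGroup

variable {A C : Type*} [Group A] [Group C]

/-- The factor group lemma, for a direct factor of prime order. -/
theorem IsHamiltonianWord.of_fst [Finite A] {p : ℕ} [Fact p.Prime] (hC : Nat.card C = p)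
    {w : List (A × C)} (hw : IsHamiltonianWord (w.map Prod.fst)) (hv : w.prod.2 ≠ 1) :
    IsHamiltonianWord (List.replicate p w).flatten := by
  have hfst : w.prod.1 = 1 := by
    have := hw.prod_eq
    rwa [show (Prod.fst : A × C → A) = MonoidHom.fst A C from rfl, List.prod_hom] at this
  have hpow (k : ℕ) : w.prod ^ k = (1, w.prod.2 ^ k) := by
    ext <;> simp [hfst]
  refine ⟨?_, ?_, ?_⟩
  · have := hw.length_eq
    rw [List.length_map] at this
    simp [this, hC, mul_comm]
  · rw [List.prod_flatten, List.map_replicate, List.prod_replicate, hpow, ← hC, pow_card_eq_one']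
    rfl
  · rintro ⟨g, z⟩
    obtain ⟨y, hy⟩ : ∃ y, (g, y) ∈ walkVertices 1 w := by
      have := hw.mem_vertices g
      have h2 := walkVertices_map (MonoidHom.fst A C) 1 w
      rw [map_one, show w.map (MonoidHom.fst A C) = w.map Prod.fst from rfl] at h2
      rw [h2, List.mem_map] at this
      obtain ⟨⟨g', y⟩, h, rfl⟩ := this
      exact ⟨y, h⟩
    -- If one copy of `w` started at 1 meets `(g, y)`, then the copy started at `(1, w.prod.2 ^ k)`
    -- meets `(g, z)` as soon as that power equals `z * y⁻¹`.
    obtain ⟨k, hk⟩ := mem_powers_of_prime_card hC hv (g' := z * y⁻¹)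
    have hord : orderOf w.prod.2 = p := orderOf_eq_prime (by rw [← hC, pow_card_eq_one']) hv
    obtain ⟨j, hj⟩ := Nat.exists_eq_add_of_lt (Nat.mod_lt k (Fact.out : p.Prime).pos)
    have hk' : w.prod.2 ^ (k % p) = z * y⁻¹ := by rw [← hord, pow_mod_orderOf]; exact hk
    rw [show p = k % p + 1 + j by omega, List.replicate_add, List.replicate_add]
    rw [List.flatten_append, List.flatten_append, walkVertices_append, walkVertices_append]
    refine List.mem_append_left _ (List.mem_append_right _ ?_)
    rw [one_mul, List.prod_flatten, List.map_replicate, List.prod_replicate, hpow, hk',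
      mem_walkVertices_iff]
    simpa [mul_assoc] using hy

/-- Each block sweeps a whole coset of `A` and moves on by `c`. Its displacement within `A` is
irrelevant, since a translate of all of `A` is all of `A`. -/
theorem mem_walkVertices_flatten (c : C) (Bs : List (List (A × C)))
    (hB : ∀ B ∈ Bs, B.prod.2 = c ∧ ∀ g, (g, (1 : C)) ∈ walkVertices 1 B) (k : ℕ)
    (hk : k < Bs.length) (g : A) : (g, c ^ k) ∈ walkVertices 1 Bs.flatten := by
  induction Bs generalizing k g with
  | nil => simp at hk
  | cons B Bs ih =>
    obtain ⟨hc, hg⟩ := hB B (by simp)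
    rw [List.flatten_cons, walkVertices_append, List.mem_append]
    cases k with
    | zero => exact Or.inl (by simpa using hg g)
    | succ k =>
      right
      have := ih (fun B' h => hB B' (by simp [h])) k (by simpa using hk) (B.prod.1⁻¹ * g)
      rw [one_mul, mem_walkVertices_iff]
      convert this using 1
      ext
      · rfl
      · simp [hc, pow_succ']

/-- In a finite group of order `N`, the power `X ^ N` of a nonempty set is a subgroup. For `X = L *
a` it contains all products of two elements of `L`, and these generate a nontrivial normal subgroup
of the simple group `A`. -/
theorem pow_image_mul_right_eq_univ [Finite A] [IsSimpleGroup A]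
    (hA : ¬ ∀ x y : A, x * y = y * x) {L : Set A} (hinv : ∀ x ∈ L, x⁻¹ ∈ L)
    (hL : Subgroup.closure L = ⊤) (a : A) {n : ℕ} (hn : Nat.card A ≤ n) :
    ((· * a) '' L) ^ n = Set.univ := by
  classical
  have := Fintype.ofFinite A
  have hne : L.Nonempty := by
    rw [Set.nonempty_iff_ne_empty]
    rintro rfl
    rw [Subgroup.closure_empty] at hL
    exact bot_ne_top hL
  set X := (· * a) '' L with hX
  have hXne : X.Nonempty := hne.image _
  -- Conjugation by `x ∈ L` preserves `J`, because `x * (u * v) * x⁻¹ = (x * u) * (v * x⁻¹)` and `L`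
  -- is symmetric; as `L` generates, `J` is normal.
  set J := Subgroup.closure {z | ∃ x ∈ L, ∃ y ∈ L, x * y = z} with hJ
  have hconj : ∀ x ∈ L, ∀ h ∈ J, x * h * x⁻¹ ∈ J := by
    intro x hx h hh
    induction hh using Subgroup.closure_induction with
    | mem z hz =>
      obtain ⟨u, hu, v, hv, rfl⟩ := hz
      rw [show x * (u * v) * x⁻¹ = (x * u) * (v * x⁻¹) by group]
      exact J.mul_mem (Subgroup.subset_closure ⟨x, hx, u, hu, rfl⟩)
        (Subgroup.subset_closure ⟨v, hv, x⁻¹, hinv x hx, rfl⟩)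
    | one => simp
    | mul y z _ _ hy hz =>
      rw [show x * (y * z) * x⁻¹ = (x * y * x⁻¹) * (x * z * x⁻¹) by group]
      exact J.mul_mem hy hz
    | inv y _ hy =>
      rw [show x * y⁻¹ * x⁻¹ = (x * y * x⁻¹)⁻¹ by group]
      exact J.inv_mem hy
  have hnormal : J.Normal := by
    rw [← Subgroup.normalizer_eq_top_iff, eq_top_iff, ← hL, Subgroup.closure_le]
    intro x hx
    rw [SetLike.mem_coe, Subgroup.mem_normalizer_iff]
    refine fun h => ⟨hconj x hx h, fun hh => ?_⟩
    have := hconj _ (hinv x hx) _ hh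
    simpa [mul_assoc] using this
  have hJtop : J = ⊤ := by
    -- If `J` is trivial, then `L` has a single element, so `A` is cyclic.
    refine (IsSimpleGroup.eq_bot_or_eq_top_of_normal J hnormal).resolve_left fun hbot => hA ?_
    obtain ⟨x₀, hx₀⟩ := hne
    have hsub : L ⊆ {x₀⁻¹} := fun x hx => by
      have : x * x₀ ∈ J := Subgroup.subset_closure ⟨x, hx, x₀, hx₀, rfl⟩
      rw [hbot, Subgroup.mem_bot] at this
      exact eq_inv_of_mul_eq_one_left this
    have htop : Subgroup.zpowers x₀⁻¹ = ⊤ := by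
      rw [Subgroup.zpowers_eq_closure, eq_top_iff, ← hL]
      exact Subgroup.closure_mono hsub
    intro x y
    obtain ⟨i, rfl⟩ := Subgroup.mem_zpowers_iff.1 (htop ▸ Subgroup.mem_top x)
    obtain ⟨j, rfl⟩ := Subgroup.mem_zpowers_iff.1 (htop ▸ Subgroup.mem_top y)
    rw [← zpow_add, ← zpow_add, add_comm]
  -- The product `x * y` equals `(x * a) * (y⁻¹ * a)⁻¹`, and the inverse is a power with exponent
  -- the group order minus 1; this makes exactly as many factors from `X` as the order of `A`.
  have hle : J ≤ powCardSubgroup X hXne := by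
    rw [hJ, Subgroup.closure_le]
    rintro _ ⟨x, hx, y, hy, rfl⟩
    have hq : y⁻¹ * a ∈ X := ⟨_, hinv y hy, rfl⟩
    have hcard : Fintype.card A = 1 + (Fintype.card A - 1) := by
      have := Fintype.card_pos (α := A); omega
    show x * y ∈ X ^ Fintype.card A
    have h1 : (y⁻¹ * a) ^ (Fintype.card A - 1) = (y⁻¹ * a)⁻¹ := by
      rw [eq_inv_iff_mul_eq_one, ← pow_succ, show Fintype.card A - 1 + 1 = Fintype.card A by omega,
        pow_card_eq_one]
    have h2 : x * y = (x * a) ^ 1 * (y⁻¹ * a) ^ (Fintype.card A - 1) := by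
      rw [h1]; group
    rw [h2, hcard, pow_add]
    refine Set.mul_mem_mul (Set.pow_mem_pow ⟨x, hx, rfl⟩) ?_
    rw [← hcard]
    exact Set.pow_mem_pow hq
  have huniv : X ^ Fintype.card A = Set.univ := by
    have htop : powCardSubgroup X hXne = ⊤ := top_le_iff.1 (hJtop.symm.trans_le hle)
    have h := congrArg (fun K : Subgroup A => (K : Set A)) htop
    exact h
  rw [Nat.card_eq_fintype_card] at hn
  obtain ⟨m, rfl⟩ := Nat.exists_eq_add_of_le hn
  rw [pow_add, huniv]
  exact Set.univ_mul hXne.pow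

theorem IsHamiltonianWord.closure_eq_top {w : List A} (hw : IsHamiltonianWord w) :
    Subgroup.closure {x | x ∈ w} = ⊤ := by
  rw [eq_top_iff]
  intro g _
  obtain ⟨u, v, rfl, -, rfl⟩ := mem_walkVertices_one_iff.1 (hw.mem_vertices g)
  exact Subgroup.list_prod_mem _ fun x hx => Subgroup.subset_closure (by simp [hx])

/-- A hamiltonian word in a finite simple group `A`, together with one more element that does not
lie in `A`, yields a hamiltonian word in the product of `A` and a large group of prime order. -/
theorem exists_hamiltonianWord_of_layers [Finite A] [IsSimpleGroup A]
    (hA : ¬ ∀ x y : A, x * y = y * x) {p : ℕ} [Fact p.Prime] (hC : Nat.card C = p)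
    (hp : Nat.card A ≤ p) {w : List A} (hw : IsHamiltonianWord w) (a : A) {c : C} (hc : c ≠ 1) :
    ∃ W : List (A × C), IsHamiltonianWord W ∧
      ∀ x ∈ W, x = (a, c) ∨ ∃ y, x = (y, 1) ∧ (y ∈ w ∨ y⁻¹ ∈ w) := by
  set L : Set A := {x | x ∈ w ∨ x⁻¹ ∈ w} with hLdef
  have hL : Subgroup.closure L = ⊤ := by
    rw [eq_top_iff, ← hw.closure_eq_top]
    exact Subgroup.closure_mono fun x hx => Or.inl hx
  have hinv : ∀ x ∈ L, x⁻¹ ∈ L := fun x hx => by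
    rcases hx with h | h
    · exact Or.inr (by simpa using h)
    · exact Or.inl h
  -- Rotating the cycle so that the letter `x` comes last and replacing it by `(a, c)` gives a block
  -- that sweeps one coset and has displacement `x⁻¹ * a` in `A`.
  have key : ∀ (w' : List A), IsHamiltonianWord w' → (∀ x ∈ w', x ∈ L) → ∀ x ∈ w',
      ∃ B : List (A × C), B.length = Nat.card A ∧ B.prod = (x⁻¹ * a, c) ∧
        (∀ g, (g, (1 : C)) ∈ walkVertices 1 B) ∧
        ∀ x ∈ B, x = (a, c) ∨ ∃ y, x = (y, 1) ∧ (y ∈ w ∨ y⁻¹ ∈ w) := by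
    intro w' hw' hL' x hx
    obtain ⟨u, v, rfl⟩ := List.append_of_mem hx
    have hr : IsHamiltonianWord ((v ++ u) ++ [x]) := by
      have : IsHamiltonianWord ((u ++ [x]) ++ v) := by simpa using hw'
      simpa using this.rotate
    have hprod : (v ++ u).prod = x⁻¹ := by
      have := hr.prod_eq
      rw [List.prod_append, List.prod_singleton] at this
      exact eq_inv_of_mul_eq_one_left this
    have hmapprod : ((v ++ u).map (MonoidHom.inl A C)).prod = (x⁻¹, 1) := by
      rw [List.prod_hom, hprod]; rfl
    refine ⟨(v ++ u).map (MonoidHom.inl A C) ++ [(a, c)], ?_, ?_, ?_, ?_⟩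
    · have := hr.length_eq
      simpa using this
    · rw [List.prod_append, hmapprod]; simp
    · intro g
      have h := hr.mem_vertices g
      rw [walkVertices_append] at h ⊢
      have h2 := walkVertices_map (MonoidHom.inl A C) 1 (v ++ u)
      rw [map_one] at h2
      rw [h2, hmapprod]
      rw [hprod] at h
      rcases List.mem_append.1 h with h | h
      · exact List.mem_append_left _ (List.mem_map_of_mem (f := MonoidHom.inl A C) h)
      · refine List.mem_append_right _ ?_
        simp only [walkVertices_cons, walkVertices_nil, one_mul, List.mem_singleton] at h ⊢
        rw [h]
    · intro z hz
      rcases List.mem_append.1 hz with hz | hz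
      · obtain ⟨y, hy, rfl⟩ := List.mem_map.1 hz
        refine Or.inr ⟨y, rfl, hL' y ?_⟩
        simp only [List.mem_append, List.mem_cons] at hy ⊢
        tauto
      · exact Or.inl (by simpa using hz)
  -- Traversing the cycle in either direction gives both `x * a` and `x⁻¹ * a` as displacements.
  have key2 : ∀ x ∈ L, ∃ B : List (A × C), B.length = Nat.card A ∧ B.prod = (x * a, c) ∧
        (∀ g, (g, (1 : C)) ∈ walkVertices 1 B) ∧
        ∀ x ∈ B, x = (a, c) ∨ ∃ y, x = (y, 1) ∧ (y ∈ w ∨ y⁻¹ ∈ w) := by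
    rintro x (hx | hx)
    · have := key _ hw.reverse ?_ x⁻¹ (by simpa using hx)
      · simpa using this
      · intro y hy
        have : y⁻¹ ∈ w := by simpa using hy
        exact Or.inr this
    · simpa using key w hw (fun y hy => Or.inl hy) x⁻¹ hx
  -- The walk closes if the `p` displacements can be chosen with product 1.
  have h1 : (1 : A) ∈ ((· * a) '' L) ^ p := by
    rw [pow_image_mul_right_eq_univ hA hinv hL a hp]; trivial
  obtain ⟨f, hf⟩ := Set.mem_pow.1 h1
  have hB : ∀ i, ∃ B : List (A × C), B.length = Nat.card A ∧ B.prod = ((f i : A), c) ∧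
        (∀ g, (g, (1 : C)) ∈ walkVertices 1 B) ∧
        ∀ x ∈ B, x = (a, c) ∨ ∃ y, x = (y, 1) ∧ (y ∈ w ∨ y⁻¹ ∈ w) := by
    intro i
    obtain ⟨x, hx, hxa⟩ := (f i).2
    rw [← hxa]
    exact key2 x hx
  choose B hBl hBp hBm hBx using hB
  refine ⟨(List.ofFn B).flatten, ⟨?_, ?_, ?_⟩, ?_⟩
  · rw [List.length_flatten, List.map_ofFn,
      show List.length ∘ B = fun _ => Nat.card A from funext hBl, List.ofFn_const]
    simp [hC, mul_comm]
  · rw [List.prod_flatten, List.map_ofFn]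
    have h3 : (List.prod ∘ B) = fun i => ((f i : A), c) := funext hBp
    rw [h3]
    ext
    · rw [← MonoidHom.coe_fst, ← List.prod_hom, List.map_ofFn]
      exact hf
    · rw [← MonoidHom.coe_snd, ← List.prod_hom, List.map_ofFn]
      have : ((MonoidHom.snd A C) ∘ fun i => ((f i : A), c)) = fun _ => c := rfl
      rw [this, List.ofFn_const, List.prod_replicate, ← hC, pow_card_eq_one']
      rfl
  · rintro ⟨g, z⟩
    obtain ⟨k, hk⟩ := mem_powers_of_prime_card hC hc (g' := z)
    have hord : orderOf c = p := orderOf_eq_prime (by rw [← hC, pow_card_eq_one']) hc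
    have hk' : c ^ (k % p) = z := by rw [← hord, pow_mod_orderOf]; exact hk
    rw [← hk']
    refine mem_walkVertices_flatten c _ ?_ _ ?_ g
    · intro D hD
      obtain ⟨i, rfl⟩ := (List.mem_ofFn' _ _).1 hD
      exact ⟨by rw [hBp], hBm i⟩
    · simpa using Nat.mod_lt k (Fact.out : p.Prime).pos
  · intro x hx
    obtain ⟨D, hD, hxD⟩ := List.mem_flatten.1 hx
    obtain ⟨i, rfl⟩ := (List.mem_ofFn' _ _).1 hD
    exact hBx i x hxD

end FactorGroup

/-! ### Stretching a closed walk on four layers -/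

/-- The steps of a walk on the four layers `A × {0, 1, 2, 3}`: `turn` stays in the layer, `up` and
`down` move to an adjacent layer, `wrapUp` moves from the layer `3` to the layer `0`, and `wrapDown`
moves from the layer `0` to the layer `3`. -/
inductive StrandStep
  | turn
  | up
  | down
  | wrapUp
  | wrapDown

namespace StrandStep

variable {A C : Type*} [Group A] [Group C]

/-- The target of a step, where `turn` multiplies by `a`, and upward steps multiply by `b`. -/
def next (a b : A) : A × ℕ → StrandStep → A × ℕ
  | (g, k), turn => (g * a, k)
  | (g, k), up => (g * b, k + 1)
  | (g, k), down => (g * b⁻¹, k - 1)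
  | (g, _), wrapUp => (g * b, 0)
  | (g, _), wrapDown => (g * b⁻¹, 3)

/-- The condition on the layer under which a step is allowed. -/
def Allowed : ℕ → StrandStep → Prop
  | _, turn => True
  | k, up => k < 3
  | k, down => 0 < k
  | k, wrapUp => k = 3
  | k, wrapDown => k = 0

/-- The word over `A × C` in which each wrapping step is replaced by `3 * m + 1` steps. -/
def expand (a b : A) (c : C) (m : ℕ) : StrandStep → List (A × C)
  | turn => [(a, 1)]
  | up => [(b, c)]
  | down => [(b, c)⁻¹]
  | wrapUp => List.replicate (3 * m + 1) (b, c)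
  | wrapDown => List.replicate (3 * m + 1) (b, c)⁻¹

/-- The states visited by a walk, except for the endpoint. -/
def states (a b : A) : A × ℕ → List StrandStep → List (A × ℕ)
  | _, [] => []
  | s, t :: L => s :: states a b (next a b s t) L

/-- The elements `g` such that the edge from `(g, 3)` to `(g * b, 0)` is used by a walk. -/
def wraps (a b : A) : A × ℕ → List StrandStep → List A
  | _, [] => []
  | s, wrapUp :: L => s.1 :: wraps a b (next a b s wrapUp) L
  | s, wrapDown :: L => (s.1 * b⁻¹) :: wraps a b (next a b s wrapDown) L
  | s, turn :: L => wraps a b (next a b s turn) L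
  | s, up :: L => wraps a b (next a b s up) L
  | s, down :: L => wraps a b (next a b s down) L

/-- All steps of the walk are allowed. -/
def Valid (a b : A) : A × ℕ → List StrandStep → Prop
  | _, [] => True
  | s, t :: L => Allowed s.2 t ∧ Valid a b (next a b s t) L

theorem mem_walkVertices_replicate (g x : A) {i n : ℕ} (h : i < n) :
    g * x ^ i ∈ walkVertices g (List.replicate n x) := by
  obtain ⟨j, rfl⟩ := Nat.exists_eq_add_of_lt h
  rw [mem_walkVertices_iff, inv_mul_cancel_left, mem_walkVertices_one_iff]
  exact ⟨List.replicate i x, List.replicate (j + 1) x, by rw [← List.replicate_add, add_assoc],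
    by simp, by simp⟩

variable {a b : A} {c : C} {m : ℕ}

theorem pow_three_mul_add_one (hb : b ^ 3 = 1) : b ^ (3 * m + 1) = b := by
  rw [pow_succ, pow_mul, hb, one_pow, one_mul]

/-- The state `(g, k)` stands for the vertex `(g, c ^ k)`. A wrapping step becomes `3 * m + 1`
steps: in `A` these amount to one factor `b`, and in `C` they close up, since `3 + (3 * m + 1)` is
the full exponent `4 + 3 * m`. -/
theorem mul_prod_expand (hb : b ^ 3 = 1) (hc : c ^ (4 + 3 * m) = 1) {s : A × ℕ} {t : StrandStep}
    (ht : Allowed s.2 t) :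
    ((s.1, c ^ s.2) : A × C) * (expand a b c m t).prod =
      ((next a b s t).1, c ^ (next a b s t).2) := by
  obtain ⟨g, k⟩ := s
  cases t with
  | turn => simp [expand, next]
  | up => simp [expand, next, pow_succ]
  | down =>
    obtain ⟨j, rfl⟩ : ∃ j, k = j + 1 := ⟨k - 1, by simp [Allowed] at ht; omega⟩
    simp [expand, next, pow_succ]
  | wrapUp =>
    obtain rfl : k = 3 := ht
    simp only [expand, next, List.prod_replicate, Prod.pow_mk, Prod.mk_mul_mk, pow_zero,
      pow_three_mul_add_one hb, ← pow_add]
    rw [show 3 + (3 * m + 1) = 4 + 3 * m by ring, hc]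
  | wrapDown =>
    obtain rfl : k = 0 := ht
    simp only [expand, next, List.prod_replicate, inv_pow, Prod.pow_mk, pow_zero,
      pow_three_mul_add_one hb, Prod.inv_mk, Prod.mk_mul_mk, one_mul]
    rw [inv_eq_of_mul_eq_one_left (a := c ^ 3)]
    rw [← pow_add, ← hc]
    congr 1
    ring

theorem mem_expand_of_mem_states (hb : b ^ 3 = 1) (hc : c ^ (4 + 3 * m) = 1) {L : List StrandStep}
    {s : A × ℕ} (hL : Valid a b s L) {x : A × ℕ} (hx : x ∈ states a b s L) :
    ((x.1, c ^ x.2) : A × C) ∈ walkVertices (s.1, c ^ s.2) (L.flatMap (expand a b c m)) := by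
  induction L generalizing s with
  | nil => simp [states] at hx
  | cons t L ih =>
    rw [List.flatMap_cons, walkVertices_append, List.mem_append, mul_prod_expand hb hc hL.1]
    rcases List.mem_cons.1 hx with rfl | hx
    · left
      cases t <;> simp [expand, List.replicate_succ]
    · exact Or.inr (ih hL.2 hx)

/-- The vertices strictly between layer 3 and the return to layer 0 split into strands, one for each
wrapping edge; the strand that starts over `h` contains them at `h * b ^ i`. -/
theorem mem_expand_of_mem_wraps (hb : b ^ 3 = 1) (hc : c ^ (4 + 3 * m) = 1) {L : List StrandStep}
    {s : A × ℕ} (hL : Valid a b s L) {h : A} (hh : h ∈ wraps a b s L) {i : ℕ} (hi0 : 1 ≤ i)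
    (hi : i ≤ 3 * m) :
    ((h * b ^ i, c ^ (3 + i)) : A × C) ∈
      walkVertices (s.1, c ^ s.2) (L.flatMap (expand a b c m)) := by
  induction L generalizing s with
  | nil => simp [wraps] at hh
  | cons t L ih =>
    rw [List.flatMap_cons, walkVertices_append, List.mem_append, mul_prod_expand hb hc hL.1]
    obtain ⟨g, k⟩ := s
    cases t with
    | turn => exact Or.inr (ih hL.2 hh)
    | up => exact Or.inr (ih hL.2 hh)
    | down => exact Or.inr (ih hL.2 hh)
    | wrapUp =>
      obtain rfl : k = 3 := hL.1
      rcases List.mem_cons.1 hh with rfl | hh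
      · left
        have := mem_walkVertices_replicate ((h, c ^ 3) : A × C) (b, c)
          (show i < 3 * m + 1 by omega)
        simpa [expand, pow_add] using this
      · exact Or.inr (ih hL.2 hh)
    | wrapDown =>
      obtain rfl : k = 0 := hL.1
      rcases List.mem_cons.1 hh with rfl | hh
      · left
        -- The strand is run backwards from its upper end, so height `i` is reached after `3 * m + 1
        -- - i` steps.
        have := mem_walkVertices_replicate ((g, c ^ 0) : A × C) (b, c)⁻¹
          (show 3 * m + 1 - i < 3 * m + 1 by omega)
        have h1 : b⁻¹ * b ^ i * b ^ (3 * m + 1 - i) = 1 := by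
          rw [mul_assoc, ← pow_add, show i + (3 * m + 1 - i) = 3 * m + 1 by omega,
            pow_three_mul_add_one hb, inv_mul_cancel]
        have h2 : c ^ (3 + i) * c ^ (3 * m + 1 - i) = 1 := by
          rw [← pow_add, show 3 + i + (3 * m + 1 - i) = 4 + 3 * m by omega, hc]
        simp only [inv_pow, Prod.pow_mk, Prod.inv_mk, Prod.mk_mul_mk, pow_zero, one_mul] at this
        rw [← eq_inv_of_mul_eq_one_left h1, ← eq_inv_of_mul_eq_one_left h2] at this
        simpa [expand, mul_assoc] using this
      · exact Or.inr (ih hL.2 hh)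

theorem length_flatMap_expand (s : A × ℕ) (L : List StrandStep) :
    (L.flatMap (expand a b c m)).length = L.length + 3 * m * (wraps a b s L).length := by
  induction L generalizing s with
  | nil => simp [wraps]
  | cons t L ih =>
    rw [List.flatMap_cons, List.length_append, ih (next a b s t)]
    cases t <;> simp [expand, wraps] <;> ring

theorem prod_flatMap_expand (hb : b ^ 3 = 1) (hc : c ^ (4 + 3 * m) = 1) {L : List StrandStep}
    {s : A × ℕ} (hL : Valid a b s L) :
    ((s.1, c ^ s.2) : A × C) * (L.flatMap (expand a b c m)).prod =
      ((L.foldl (next a b) s).1, c ^ (L.foldl (next a b) s).2) := by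
  induction L generalizing s with
  | nil => simp
  | cons t L ih =>
    rw [List.flatMap_cons, List.prod_append, ← mul_assoc, mul_prod_expand hb hc hL.1, ih hL.2,
      List.foldl_cons]

/-- A closed walk on four layers that visits every vertex and uses all of the edges from the
layer `3` to the layer `0` can be expanded to any number `4 + 3 * m` of layers. -/
theorem isHamiltonianWord_expand [Finite A] {p : ℕ} [Fact p.Prime] (hC : Nat.card C = p)
    (hp : p = 4 + 3 * m) (hb : b ^ 3 = 1) (hc : c ≠ 1) {L : List StrandStep}
    (hlen : L.length = 4 * Nat.card A) (hend : L.foldl (next a b) (1, 0) = (1, 0))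
    (hvalid : Valid a b (1, 0) L) (hstates : ∀ g, ∀ k < 4, (g, k) ∈ states a b (1, 0) L)
    (hwlen : (wraps a b (1, 0) L).length = Nat.card A) (hwraps : ∀ g, g ∈ wraps a b (1, 0) L) :
    IsHamiltonianWord (L.flatMap (expand a b c m)) := by
  have hcp : c ^ (4 + 3 * m) = 1 := by rw [← hp, ← hC, pow_card_eq_one']
  refine ⟨?_, ?_, ?_⟩
  · rw [length_flatMap_expand (1, 0), hlen, hwlen, Nat.card_prod, hC, hp]
    ring
  · have := prod_flatMap_expand hb hcp hvalid
    rw [hend] at this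
    simpa using this
  · rintro ⟨g, z⟩
    obtain ⟨k, hk⟩ := mem_powers_of_prime_card hC hc (g' := z)
    have hord : orderOf c = p := orderOf_eq_prime (by rw [← hC, pow_card_eq_one']) hc
    have hk' : c ^ (k % p) = z := by rw [← hord, pow_mod_orderOf]; exact hk
    have hlt := Nat.mod_lt k (Fact.out : p.Prime).pos
    rw [← hk']
    by_cases h4 : k % p < 4
    · have := mem_expand_of_mem_states hb hcp hvalid (hstates g _ h4)
      simp only [pow_zero] at this
      exact this
    -- From layer 4 on, the vertex lies on a strand; going back `k % p - 3` factors of `b` gives its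
    -- start in layer 3.
    · have := mem_expand_of_mem_wraps hb hcp hvalid (hwraps (g * (b ^ (k % p - 3))⁻¹))
        (i := k % p - 3) (by omega) (by omega)
      rw [show 3 + (k % p - 3) = k % p by omega, inv_mul_cancel_right] at this
      simp only [pow_zero] at this
      exact this

theorem mem_flatMap_expand {L : List StrandStep} {x : A × C}
    (hx : x ∈ L.flatMap (expand a b c m)) : x = (a, 1) ∨ x = (b, c) ∨ x = (b, c)⁻¹ := by
  obtain ⟨t, -, ht⟩ := List.mem_flatMap.1 hx
  cases t <;> simp [expand, List.mem_replicate] at ht <;> simp [ht]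

end StrandStep

/-! ### Numerical codes for permutations and the verification of words -/

/-- The base `8` digit of `c` in the position `i`. -/
def octalDigit (c i : ℕ) : ℕ := c / 8 ^ i % 8

/-- The code of a permutation of `Fin 5`: its values are the base `8` digits. -/
def permCode (g : Equiv.Perm (Fin 5)) : ℕ :=
  g 0 + 8 * g 1 + 64 * g 2 + 512 * g 3 + 4096 * g 4

/-- Composition of permutations, in terms of codes. -/
def mulCode (c d : ℕ) : ℕ :=
  octalDigit c (octalDigit d 0) + 8 * octalDigit c (octalDigit d 1) +
    64 * octalDigit c (octalDigit d 2) + 512 * octalDigit c (octalDigit d 3) +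
    4096 * octalDigit c (octalDigit d 4)

theorem octalDigit_permCode (g : Equiv.Perm (Fin 5)) (i : Fin 5) :
    octalDigit (permCode g) i = g i := by
  have h0 := (g 0).2
  have h1 := (g 1).2
  have h2 := (g 2).2
  have h3 := (g 3).2
  have h4 := (g 4).2
  fin_cases i <;> simp [octalDigit, permCode] <;> omega

theorem permCode_mul (g h : Equiv.Perm (Fin 5)) :
    permCode (g * h) = mulCode (permCode g) (permCode h) := by
  have (i : Fin 5) : octalDigit (permCode g) (octalDigit (permCode h) i) = (g * h) i := by
    rw [octalDigit_permCode, octalDigit_permCode, Equiv.Perm.mul_apply]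
  rw [mulCode, permCode, ← this, ← this, ← this, ← this, ← this]
  rfl

theorem permCode_injective : Function.Injective permCode := fun g h hgh => by
  ext i
  rw [← octalDigit_permCode, ← octalDigit_permCode, hgh]

/-- The code of an element of the alternating group. -/
def altCode (g : alternatingGroup (Fin 5)) : ℕ := permCode g

theorem altCode_mul (g h : alternatingGroup (Fin 5)) :
    altCode (g * h) = mulCode (altCode g) (altCode h) := permCode_mul _ _

theorem altCode_injective : Function.Injective altCode := fun _ _ h =>
  Subtype.ext (permCode_injective h)

theorem altCode_one : altCode 1 = 18056 := rfl

theorem natCard_alternatingGroup_five : Nat.card (alternatingGroup (Fin 5)) = 60 := by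
  rw [nat_card_alternatingGroup]
  simp [Nat.factorial]

/-- Evaluate `f n` after evaluating `n`. -/
def forceNat (n : ℕ) (f : ℕ → Bool) : Bool :=
  match n with
  | 0 => f 0
  | k + 1 => f (k + 1)

@[simp] theorem forceNat_eq (n : ℕ) (f : ℕ → Bool) : forceNat n f = f n := by
  cases n <;> rfl

/-- The `n` lowest digits of `w` in base `b`, starting at the position `k`. -/
def lowDigits (b w : ℕ) : ℕ → ℕ → List ℕ
  | _, 0 => []
  | k, n + 1 => (w / b ^ k % b) :: lowDigits b w (k + 1) n

theorem length_lowDigits (b w k n : ℕ) : (lowDigits b w k n).length = n := by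
  induction n generalizing k with
  | zero => rfl
  | succ n ih => simp [lowDigits, ih]

theorem lt_of_mem_lowDigits {b w k n d : ℕ} (hb : 0 < b) (hd : d ∈ lowDigits b w k n) : d < b := by
  induction n generalizing k with
  | zero => simp [lowDigits] at hd
  | succ n ih =>
    rcases List.mem_cons.1 hd with rfl | hd
    · exact Nat.mod_lt _ hb
    · exact ih hd

/-- Check that a walk on codes is closed and does not visit a vertex twice. The letter `d` stands
for multiplication with the code `t d`. -/
def checkWalk (t : ℕ → ℕ) : List ℕ → ℕ → List ℕ → Bool
  | [], g, _ => Nat.beq g 18056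
  | d :: w, g, visited => !(visited.any (Nat.beq g)) &&
      forceNat (mulCode g (t d)) fun g' => checkWalk t w g' (g :: visited)

/-- Induction along the walk, where `visited` holds the codes of earlier vertices. The number 18056
is the code of the identity. -/
theorem checkWalk_spec {t : ℕ → ℕ} {ev : ℕ → alternatingGroup (Fin 5)} {w : List ℕ}
    (ht : ∀ d ∈ w, altCode (ev d) = t d) {g : alternatingGroup (Fin 5)} {visited : List ℕ}
    (hw : checkWalk t w (altCode g) visited = true) :
    g * (w.map ev).prod = 1 ∧ (walkVertices g (w.map ev)).Nodup ∧
      ∀ x ∈ walkVertices g (w.map ev), altCode x ∉ visited := by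
  induction w generalizing g visited with
  | nil =>
    refine ⟨?_, by simp, by simp⟩
    rw [List.map_nil, List.prod_nil, mul_one]
    exact altCode_injective (Nat.eq_of_beq_eq_true hw)
  | cons d w ih =>
    simp only [checkWalk, forceNat_eq, Bool.and_eq_true, Bool.not_eq_true', List.any_eq_false] at hw
    rw [← ht d (by simp), ← altCode_mul] at hw
    obtain ⟨h1, h2, h3⟩ := ih (fun e he => ht e (by simp [he])) hw.2
    have hg : altCode g ∉ visited := fun h => hw.1 _ h (Nat.beq_refl _)
    refine ⟨by simpa [mul_assoc] using h1, ?_, ?_⟩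
    · rw [List.map_cons, walkVertices_cons, List.nodup_cons]
      exact ⟨fun h => h3 _ h (by simp), h2⟩
    · intro x hx
      rcases List.mem_cons.1 hx with rfl | hx
      · exact hg
      · exact fun h => h3 _ hx (by simp [h])

/-- The letters `2 * i` and `2 * i + 1` stand for `s i` and its inverse. -/
def evalLetter {G : Type*} [Group G] (s : Fin 3 → G) (d : ℕ) : G :=
  if d % 2 = 0 then s (Fin.ofNat 3 (d / 2)) else (s (Fin.ofNat 3 (d / 2)))⁻¹

theorem map_evalLetter {G H : Type*} [Group G] [Group H] (f : G →* H) (s : Fin 3 → G) (d : ℕ) :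
    f (evalLetter s d) = evalLetter (fun i => f (s i)) d := by
  unfold evalLetter
  split_ifs <;> simp

/-- The codes in `T` are those of the values of the six letters. -/
def IsLetterCode (s : Fin 3 → alternatingGroup (Fin 5)) (T : List ℕ) : Prop :=
  ∀ d < 6, altCode (evalLetter s d) = T.getD d 0

theorem isHamiltonianWord_of_checkWalk {s : Fin 3 → alternatingGroup (Fin 5)} {T : List ℕ}
    (hT : IsLetterCode s T) {w : ℕ}
    (hw : checkWalk (T.getD · 0) (lowDigits 6 w 0 60) 18056 [] = true) :
    IsHamiltonianWord ((lowDigits 6 w 0 60).map (evalLetter s)) := by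
  have h := checkWalk_spec (ev := evalLetter s) (g := 1)
    (fun d hd => hT d (lt_of_mem_lowDigits (by norm_num) hd)) hw
  refine IsHamiltonianWord.of_nodup ?_ (by simpa using h.1) h.2.1
  rw [List.length_map, length_lowDigits, natCard_alternatingGroup_five]

/-! ### Exponent sums -/

/-- The exponent sum of the `i`th generator in a word. -/
def exponentSum (i : ℕ) : List ℕ → ℤ
  | [] => 0
  | d :: w => (if d / 2 % 3 = i then (if d % 2 = 0 then 1 else -1) else 0) + exponentSum i w

theorem toAdd_prod_evalLetter {p : ℕ} (z : Fin 3 → Multiplicative (ZMod p)) (w : List ℕ) :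
    (w.map (evalLetter z)).prod.toAdd = exponentSum 0 w * (z 0).toAdd +
      exponentSum 1 w * (z 1).toAdd + exponentSum 2 w * (z 2).toAdd := by
  induction w with
  | nil => simp [exponentSum]
  | cons d w ih =>
    rw [List.map_cons, List.prod_cons, toAdd_mul, ih]
    have hlt : d / 2 % 3 < 3 := Nat.mod_lt _ (by norm_num)
    have hf : Fin.ofNat 3 (d / 2) = ⟨d / 2 % 3, hlt⟩ := rfl
    simp only [exponentSum, evalLetter, hf]
    generalize d / 2 % 3 = i at hlt
    interval_cases i <;> by_cases hd : d % 2 = 0 <;> simp [hd] <;> ring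

/-- The determinant of the exponent sums of three words. -/
def exponentDet (u v w : List ℕ) : ℤ :=
  exponentSum 0 u * (exponentSum 1 v * exponentSum 2 w - exponentSum 2 v * exponentSum 1 w) -
  exponentSum 1 u * (exponentSum 0 v * exponentSum 2 w - exponentSum 2 v * exponentSum 0 w) +
  exponentSum 2 u * (exponentSum 0 v * exponentSum 1 w - exponentSum 1 v * exponentSum 0 w)

/-- If all three products were trivial, the components of `z` would solve a homogeneous linear
system whose determinant is nonzero modulo `p`, being a nonzero integer smaller than `p` in absolute
value. -/
theorem exists_prod_ne_one {p : ℕ} [Fact p.Prime] {u v w : List ℕ}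
    (h0 : exponentDet u v w ≠ 0) (hp : (exponentDet u v w).natAbs < p)
    {z : Fin 3 → Multiplicative (ZMod p)} (hz : ∃ i, z i ≠ 1) :
    ∃ x ∈ [u, v, w], (x.map (evalLetter z)).prod ≠ 1 := by
  by_contra! hcon
  have hd : ((exponentDet u v w : ℤ) : ZMod p) ≠ 0 := by
    rw [Ne, ZMod.intCast_zmod_eq_zero_iff_dvd, Int.natCast_dvd]
    exact Nat.not_dvd_of_pos_of_lt (Int.natAbs_pos.2 h0) hp
  have e (x : List ℕ) (hx : x ∈ [u, v, w]) := toAdd_prod_evalLetter z x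
  have eu := e u (by simp)
  have ev := e v (by simp)
  have ew := e w (by simp)
  rw [hcon _ (by simp), toAdd_one] at eu ev ew
  obtain ⟨i, hi⟩ := hz
  refine hi (Multiplicative.toAdd.injective ?_)
  rw [toAdd_one]
  apply (mul_eq_zero.1 (?_ : ((exponentDet u v w : ℤ) : ZMod p) * (z i).toAdd = 0)).resolve_left hd
  simp only [exponentDet]
  push_cast
  generalize (exponentSum 0 u : ZMod p) = a0, (exponentSum 1 u : ZMod p) = a1,
    (exponentSum 2 u : ZMod p) = a2, (exponentSum 0 v : ZMod p) = b0,
    (exponentSum 1 v : ZMod p) = b1, (exponentSum 2 v : ZMod p) = b2,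
    (exponentSum 0 w : ZMod p) = c0, (exponentSum 1 w : ZMod p) = c1,
    (exponentSum 2 w : ZMod p) = c2 at *
  -- Cramer's rule: the coefficients are, up to sign, the cofactors of column `i`.
  obtain rfl | rfl | rfl : i = 0 ∨ i = 1 ∨ i = 2 := by fin_cases i <;> simp
  · linear_combination (-(b1 * c2 - b2 * c1)) * eu + (a1 * c2 - a2 * c1) * ev
      - (a1 * b2 - a2 * b1) * ew
  · linear_combination (b0 * c2 - b2 * c0) * eu - (a0 * c2 - a2 * c0) * ev
      + (a0 * b2 - a2 * b0) * ew
  · linear_combination (-(b0 * c1 - b1 * c0)) * eu + (a0 * c1 - a1 * c0) * ev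
      - (a0 * b1 - a1 * b0) * ew

/-! ### The walk for the generators of orders 2 and 3 -/

namespace StrandStep

/-- The steps are numbered from `0` to `4`. -/
def ofDigit : ℕ → StrandStep
  | 0 => turn
  | 1 => up
  | 2 => down
  | 3 => wrapUp
  | _ => wrapDown

/-- Check a walk on four layers, in terms of codes: `ca`, `cb` and `cb'` are the codes of the two
generators and of the inverse of the second one. -/
def check (ca cb cb' : ℕ) : List StrandStep → ℕ → ℕ → List ℕ → List ℕ → Bool
  | [], g, k, visited, wrapped => Nat.beq g 18056 && Nat.beq k 0 && Nat.beq wrapped.length 60 &&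
      Nat.beq visited.length 240
  | t :: L, g, k, visited, wrapped =>
    -- The state `(g, k)` is recorded as the single number `4 * g + k`.
    forceNat (4 * g + k) fun v => !(visited.any (Nat.beq v)) &&
      match t with
      | turn => forceNat (mulCode g ca) fun g' => check ca cb cb' L g' k (v :: visited) wrapped
      | up => Nat.blt k 3 && forceNat (mulCode g cb) fun g' => forceNat (k + 1) fun k' =>
          check ca cb cb' L g' k' (v :: visited) wrapped
      | down => Nat.blt 0 k && forceNat (mulCode g cb') fun g' => forceNat (k - 1) fun k' =>
          check ca cb cb' L g' k' (v :: visited) wrapped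
      | wrapUp => Nat.beq k 3 && !(wrapped.any (Nat.beq g)) && forceNat (mulCode g cb) fun g' =>
          check ca cb cb' L g' 0 (v :: visited) (g :: wrapped)
      | wrapDown => Nat.beq k 0 && forceNat (mulCode g cb') fun g' =>
          !(wrapped.any (Nat.beq g')) &&
          check ca cb cb' L g' 3 (v :: visited) (g' :: wrapped)

end StrandStep

namespace StrandStep

/-- The final length tests become counts: 240 distinct states and 60 distinct wrapping edges, which
for a walk started with empty lists is all of them. -/
theorem check_spec {a b : alternatingGroup (Fin 5)} {L : List StrandStep}
    {g : alternatingGroup (Fin 5)} {k : ℕ} {visited wrapped : List ℕ} (hk : k < 4)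
    (h : check (altCode a) (altCode b) (altCode b⁻¹) L (altCode g) k visited wrapped = true) :
    Valid a b (g, k) L ∧ L.foldl (next a b) (g, k) = (1, 0) ∧
      L.length + visited.length = 240 ∧ (wraps a b (g, k) L).length + wrapped.length = 60 ∧
      (states a b (g, k) L).length = L.length ∧ (states a b (g, k) L).Nodup ∧
      (∀ s ∈ states a b (g, k) L, s.2 < 4 ∧ 4 * altCode s.1 + s.2 ∉ visited) ∧
      (wraps a b (g, k) L).Nodup ∧ ∀ x ∈ wraps a b (g, k) L, altCode x ∉ wrapped := by
  induction L generalizing g k visited wrapped with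
  | nil =>
    simp only [check, Bool.and_eq_true, Nat.beq_eq] at h
    obtain ⟨⟨⟨h1, h2⟩, h3⟩, h4⟩ := h
    obtain rfl : g = 1 := altCode_injective h1
    simp [Valid, states, wraps, h2, h3, h4]
  | cons t L ih =>
    simp only [check, forceNat_eq, Bool.and_eq_true, Bool.not_eq_true', List.any_eq_false] at h
    obtain ⟨hv, h⟩ := h
    replace hv : 4 * altCode g + k ∉ visited := fun hm => hv _ hm (Nat.beq_refl _)
    -- Bookkeeping for the visited states, common to all kinds of step; `glueWrap` does the same for
    -- the wrapping edges.
    have glue : ∀ {s : alternatingGroup (Fin 5) × ℕ},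
        L.length + ((4 * altCode g + k) :: visited).length = 240 →
        (states a b s L).length = L.length → (states a b s L).Nodup →
        (∀ x ∈ states a b s L, x.2 < 4 ∧ 4 * altCode x.1 + x.2 ∉ (4 * altCode g + k) :: visited) →
        (t :: L).length + visited.length = 240 ∧
        ((g, k) :: states a b s L).length = (t :: L).length ∧ ((g, k) :: states a b s L).Nodup ∧
        ∀ x ∈ (g, k) :: states a b s L, x.2 < 4 ∧ 4 * altCode x.1 + x.2 ∉ visited := by
      intro s h1 h2 h3 h4
      refine ⟨by simp at h1 ⊢; omega, by simp [h2], ?_, ?_⟩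
      · exact List.nodup_cons.2 ⟨fun hm => (h4 _ hm).2 (by simp), h3⟩
      · intro x hx
        rcases List.mem_cons.1 hx with rfl | hx
        · exact ⟨hk, hv⟩
        · exact ⟨(h4 x hx).1, fun hm => (h4 x hx).2 (by simp [hm])⟩
    have glueWrap : ∀ {s : alternatingGroup (Fin 5) × ℕ} {y : alternatingGroup (Fin 5)},
        (∀ x ∈ wrapped, ¬ Nat.beq (altCode y) x = true) →
        (wraps a b s L).length + (altCode y :: wrapped).length = 60 → (wraps a b s L).Nodup →
        (∀ x ∈ wraps a b s L, altCode x ∉ altCode y :: wrapped) →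
        (y :: wraps a b s L).length + wrapped.length = 60 ∧ (y :: wraps a b s L).Nodup ∧
        ∀ x ∈ y :: wraps a b s L, altCode x ∉ wrapped := by
      intro s y h0 h1 h2 h3
      refine ⟨by simp at h1 ⊢; omega, ?_, ?_⟩
      · exact List.nodup_cons.2 ⟨fun hm => h3 _ hm (by simp), h2⟩
      · intro x hx
        rcases List.mem_cons.1 hx with rfl | hx
        · exact fun hm => h0 _ hm (Nat.beq_refl _)
        · exact fun hm => h3 x hx (by simp [hm])
    cases t with
    | turn =>
      rw [← altCode_mul] at h
      obtain ⟨i1, i2, i3, i4, i5, i6, i7, i8, i9⟩ := ih hk h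
      obtain ⟨j1, j2, j3, j4⟩ := glue i3 i5 i6 i7
      exact ⟨⟨trivial, i1⟩, i2, j1, i4, j2, j3, j4, i8, i9⟩
    | up =>
      rw [Bool.and_eq_true, ← altCode_mul, Nat.blt_eq] at h
      obtain ⟨i1, i2, i3, i4, i5, i6, i7, i8, i9⟩ := ih (by omega) h.2
      obtain ⟨j1, j2, j3, j4⟩ := glue i3 i5 i6 i7
      exact ⟨⟨h.1, i1⟩, i2, j1, i4, j2, j3, j4, i8, i9⟩
    | down =>
      rw [Bool.and_eq_true, ← altCode_mul, Nat.blt_eq] at h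
      obtain ⟨i1, i2, i3, i4, i5, i6, i7, i8, i9⟩ := ih (by omega) h.2
      obtain ⟨j1, j2, j3, j4⟩ := glue i3 i5 i6 i7
      exact ⟨⟨h.1, i1⟩, i2, j1, i4, j2, j3, j4, i8, i9⟩
    | wrapUp =>
      simp only [Bool.and_eq_true, Bool.not_eq_true', List.any_eq_false, ← altCode_mul,
        Nat.beq_eq] at h
      obtain ⟨⟨h1, h2⟩, h3⟩ := h
      obtain ⟨i1, i2, i3, i4, i5, i6, i7, i8, i9⟩ := ih (by omega) h3
      obtain ⟨j1, j2, j3, j4⟩ := glue i3 i5 i6 i7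
      obtain ⟨l1, l2, l3⟩ := glueWrap (by simpa using h2) i4 i8 i9
      exact ⟨⟨h1, i1⟩, i2, j1, l1, j2, j3, j4, l2, l3⟩
    | wrapDown =>
      simp only [Bool.and_eq_true, Bool.not_eq_true', List.any_eq_false, ← altCode_mul,
        Nat.beq_eq] at h
      obtain ⟨h1, h2, h3⟩ := h
      obtain ⟨i1, i2, i3, i4, i5, i6, i7, i8, i9⟩ := ih (by omega) h3
      obtain ⟨j1, j2, j3, j4⟩ := glue i3 i5 i6 i7
      obtain ⟨l1, l2, l3⟩ := glueWrap (by simpa using h2) i4 i8 i9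
      exact ⟨⟨h1, i1⟩, i2, j1, l1, j2, j3, j4, l2, l3⟩

/-- A closed walk on four layers over the alternating group of degree `5`, in base `5`. -/
def walkNumber : ℕ :=
  367222164414351545171076545939980143229884135294008155261051375041872297776972376387267252497285832116669427581091376192935698251720418182435569401879971304000947909631

/-- The codes 14416, 16537 and 17027 belong to `(1 2)(3 4)`, `(0 1 3)` and the inverse of the
latter. -/
theorem check_walkNumber :
    check 14416 16537 17027 ((lowDigits 5 walkNumber 0 240).map ofDigit) 18056 0 [] [] = true := by
  decide +kernel

/-- If `a` and `b` are the standard generators of orders `2` and `3` of the alternating group, then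
`(a, 1)` and `(b, c)` admit a hamiltonian word. -/
theorem exists_hamiltonianWord {C : Type*} [Group C] {p m : ℕ} [Fact p.Prime]
    (hC : Nat.card C = p) (hp : p = 4 + 3 * m) {c : C} (hc : c ≠ 1)
    {a b : alternatingGroup (Fin 5)} (ha : altCode a = 14416) (hb : altCode b = 16537)
    (hb' : altCode b⁻¹ = 17027) :
    ∃ W : List (alternatingGroup (Fin 5) × C), IsHamiltonianWord W ∧
      ∀ x ∈ W, x = (a, 1) ∨ x = (b, c) ∨ x = (b, c)⁻¹ := by
  set L := (lowDigits 5 walkNumber 0 240).map ofDigit with hL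
  have hcheck := check_walkNumber
  rw [← ha, ← hb, ← hb', ← hL, ← altCode_one] at hcheck
  obtain ⟨h1, h2, h3, h4, h5, h6, h7, h8, -⟩ := check_spec (by norm_num) hcheck
  have hb3 : b ^ 3 = 1 := by
    apply altCode_injective
    rw [pow_succ, pow_two, altCode_mul, altCode_mul, hb]
    rfl
  refine ⟨L.flatMap (expand a b c m), isHamiltonianWord_expand hC hp hb3 hc ?_ h2 h1 ?_ ?_ ?_,
    fun x hx => mem_flatMap_expand hx⟩
  · rw [natCard_alternatingGroup_five]; simpa using h3
  -- The 240 distinct states fill `A × {0, 1, 2, 3}`, which has `60 * 4` elements.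
  · have hsub : (states a b (1, 0) L).toFinset ⊆ Finset.univ ×ˢ Finset.range 4 := by
      intro s hs
      have := (h7 s (List.mem_toFinset.1 hs)).1
      simpa using this
    have hcard := Finset.eq_of_subset_of_card_le hsub (by
      rw [List.toFinset_card_of_nodup h6, h5, Finset.card_product, Finset.card_univ,
        ← Nat.card_eq_fintype_card, natCard_alternatingGroup_five, Finset.card_range]
      simp at h3; omega)
    intro g k hk
    rw [← List.mem_toFinset, hcard]
    simpa using hk
  · rw [natCard_alternatingGroup_five]; simpa using h4
  · intro g
    have : (wraps a b (1, 0) L).toFinset = Finset.univ := by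
      rw [← Finset.card_eq_iff_eq_univ, List.toFinset_card_of_nodup h8,
        ← Nat.card_eq_fintype_card, natCard_alternatingGroup_five]
      simpa using h4
    rw [← List.mem_toFinset, this]
    exact Finset.mem_univ g

end StrandStep

/-! ### Generating triples up to automorphisms -/

/-- The code of the inverse of a permutation. -/
def invCode (c : ℕ) : ℕ :=
  8 ^ octalDigit c 1 + 2 * 8 ^ octalDigit c 2 + 3 * 8 ^ octalDigit c 3 + 4 * 8 ^ octalDigit c 4

theorem permCode_eq_sum (g : Equiv.Perm (Fin 5)) : permCode g = ∑ i, (g i : ℕ) * 8 ^ (i : ℕ) := by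
  rw [Fin.sum_univ_five]
  simp [permCode]
  ring

/-- Reindexing the sum of `g⁻¹ i * 8 ^ i` along `g` turns it into the sum of `j * 8 ^ g j`, which
`invCode` computes. -/
theorem permCode_inv (g : Equiv.Perm (Fin 5)) : permCode g⁻¹ = invCode (permCode g) := by
  have h (i : Fin 5) := octalDigit_permCode g i
  have h1 := h 1
  have h2 := h 2
  have h3 := h 3
  have h4 := h 4
  simp only [Fin.isValue, Fin.val_one, Fin.val_two] at h1 h2
  rw [permCode_eq_sum, ← Equiv.sum_comp g, Fin.sum_univ_five, invCode, h1, h2,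
    show octalDigit (permCode g) 3 = g 3 from h3, show octalDigit (permCode g) 4 = g 4 from h4]
  simp

theorem altCode_inv (g : alternatingGroup (Fin 5)) : altCode g⁻¹ = invCode (altCode g) :=
  permCode_inv _

/-- Check that a number is the code of a permutation. -/
def isPermCode (s : ℕ) : Bool :=
  decide (octalDigit s 0 < 5 ∧ octalDigit s 1 < 5 ∧ octalDigit s 2 < 5 ∧ octalDigit s 3 < 5 ∧
    octalDigit s 4 < 5 ∧
    [octalDigit s 0, octalDigit s 1, octalDigit s 2, octalDigit s 3, octalDigit s 4].Nodup ∧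
    octalDigit s 0 + 8 * octalDigit s 1 + 64 * octalDigit s 2 + 512 * octalDigit s 3 +
      4096 * octalDigit s 4 = s)

theorem exists_permCode_eq {s : ℕ} (hs : isPermCode s = true) : ∃ σ, permCode σ = s := by
  obtain ⟨h0, h1, h2, h3, h4, hn, he⟩ := of_decide_eq_true hs
  have hinj : Function.Injective
      (![⟨_, h0⟩, ⟨_, h1⟩, ⟨_, h2⟩, ⟨_, h3⟩, ⟨_, h4⟩] : Fin 5 → Fin 5) := by
    intro i j hij
    simp only [List.nodup_cons, List.mem_cons, List.not_mem_nil, or_false, not_or] at hn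
    fin_cases i <;> fin_cases j <;> simp at hij <;> first | rfl | (exfalso; omega)
  exact ⟨Equiv.ofBijective _ (Finite.injective_iff_bijective.1 hinj), he⟩

/-- Triples of generators of the alternating group of degree `5`, given by their codes and those of
their inverses, and for each of them three hamiltonian words with independent exponent sums. -/
def certificates : List (List ℕ × ℕ × ℕ × ℕ) :=
  [
    ([10440, 13576, 17937, 17986, 17937, 17986],
      26152799603229615697736934596531662920780634027,
      34284012851599085047212375053262769969012317172,
      47540188984952135226938169415986765633966058267),
    ([10440, 13576, 2257, 13380, 2257, 13380],
      32703278143193129263918130703091569680019828764,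
      10842113195923803326003817408739552434509109308,
      13737364479637562677153695201073042709209036861),
    ([10440, 13576, 2138, 12820, 2138, 12820],
      875253225887293386160899643309178640634011386,
      15219621773802252358356405175637691476479386326,
      19019876249611020382768081831411847165207715595),
    ([14416, 14416, 2257, 13380, 2257, 13380],
      15154077935999834369268731353100262991015784651,
      25412456867966389030412401792985189801841855505,
      33215472537572320182510310206948547583043802064),
    ([14416, 14416, 1305, 8900, 1305, 8900],
      24962673120295460290186219065797995692561997363,
      14646312539741788194144959637174209259316390216,
      13495037845067175324951767535905514759556996149),
    ([2257, 13380, 12561, 10307, 12561, 10307],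
      455756060245830948196038232305593228738757612,
      47933106695623259920369962092840053599827953902,
      33534868698163933399979565854402244670120667638),
    ([2257, 13380, 10265, 13058, 10265, 13058],
      10002913171765413235058549848334796792622810377,
      6788884058257318189571204962850765914547279027,
      42398158274045515732556559384374142985458242551),
    ([14416, 14416, 14465, 14465, 10440, 13576],
      48416393431201086250275415513964545182907085208,
      8024264047460888963743124692954690885817620442,
      33662159879515296267662872277081030038802091337),
    ([14416, 14416, 17601, 17601, 10440, 13576],
      24230323194737594515684443997720804103067813160,
      16094462307703881293024243699631846068007938483,
      46141487856081689735411754760341021428479134745),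
    ([14416, 14416, 14465, 14465, 6296, 12960],
      44524176700502851046361488009038369016465879027,
      15587124025793987980604634912489265180062893859,
      38187935168813135717448844929032538541131667544),
    ([14416, 14416, 10440, 13576, 2187, 12428],
      37513991647153112530230022496195646172850248711,
      29588917444357909644284106877794275725710322717,
      14252710685910834061836291543656182442506295512),
    ([14416, 14416, 17601, 17601, 17104, 17496],
      14593836103406129487315459455258896398955537864,
      16208083737753087852987346613054820367078527754,
      22766509927606843900724059862191244927740479130),
    ([10440, 13576, 17104, 17496, 16586, 17419],
      3390323360144197511636851704984983786890264574,
      43942279853239369244530247901937035346236499231,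
      17164697712269509094178544579142291372404498992),
    ([14416, 14416, 8984, 8984, 14465, 14465],
      23820340351291820017507989589337298550970743217,
      35408430259811228769374156604541640208133317752,
      31392696283340329115921986248155809295242494516),
    ([14416, 14416, 8984, 8984, 17601, 17601],
      5736441964839740071771449652251894211210227449,
      14315913687648587832964397218313511070578688546,
      37594597653012233310546610160183506125333402638),
    ([14416, 14416, 14465, 14465, 17601, 17601],
      14085765948870932239156949883375811305531197834,
      41420388511322063135960457934002044515282855050,
      15075974183281814590108875326246669166062689385),
    ([14416, 14416, 14465, 14465, 16922, 16922],
      45851916720962647117474566095794199840180498748,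
      31342410680958296300803473217241354383716609743,
      41616253575412561152856190610808334386124359159),
    ([14416, 14416, 14465, 14465, 8459, 8459],
      23966204099378367619161044787270743152939270462,
      36447373342276651848950427024097325968074125611,
      3766861453452073399596024744520395762131333782),
    ([14416, 14416, 17601, 17601, 4259, 4259],
      36546893553814914855924758014080607209817024507,
      7629241306268262644824768414868473127125836050,
      6143449254698363874389235484178043577132884827)]

/-- The remaining triple of generators. -/
def exceptionalTriple : List ℕ := [14416, 14416, 16537, 17027, 16537, 17027]

/-- Up to automorphisms, each set of generators contains one of these triples up to inverses. -/
def generatingTriples : List (List ℕ) := exceptionalTriple :: certificates.map Prod.fst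

/-- Some automorphism maps a triple of elements of `S` to one of the listed triples. -/
def HasGeneratingTriple (S : Set (alternatingGroup (Fin 5))) : Prop :=
  ∃ (φ : alternatingGroup (Fin 5) ≃* alternatingGroup (Fin 5)), ∃ T ∈ generatingTriples,
    ∃ s : Fin 3 → alternatingGroup (Fin 5), (∀ i, s i ∈ S) ∧ IsLetterCode (fun i => φ (s i)) T

/-- Search for a number in a list. -/
def memCode (l : List ℕ) (x : ℕ) : Bool := l.any (Nat.beq x)

theorem memCode_iff {l : List ℕ} {x : ℕ} : memCode l x = true ↔ x ∈ l := by
  simp [memCode]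

/-- Check that the permutation with code `s` conjugates the element with code `x` to the one with
code `y`. -/
def checkConj (s x y : ℕ) : Bool :=
  forceNat (mulCode s x) fun c => forceNat (invCode s) fun d => Nat.beq (mulCode c d) y

/-- Check that the permutation with code `s` conjugates some of the elements with the codes `u`,
`v`, `w` and their inverses to the triple with number `i`. -/
def checkEntry : ℕ × ℕ × ℕ × ℕ × ℕ → Bool
  | (u, v, w, s, i) => isPermCode s && Nat.blt i generatingTriples.length &&
      -- Even positions of a listed triple hold the generators, odd positions their inverses.
      [0, 2, 4].all fun j =>
        Nat.beq (invCode ((generatingTriples.getD i []).getD j 0))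
          ((generatingTriples.getD i []).getD (j + 1) 0) &&
        [u, v, w].any fun x => checkConj s x ((generatingTriples.getD i []).getD j 0) ||
          forceNat (invCode x) fun x' => checkConj s x' ((generatingTriples.getD i []).getD j 0)

theorem altCode_conjNormal_of_checkConj {σ : Equiv.Perm (Fin 5)} {x : alternatingGroup (Fin 5)}
    {y : ℕ} (h : checkConj (permCode σ) (altCode x) y = true) :
    altCode (MulAut.conjNormal σ x) = y := by
  simp only [checkConj, forceNat_eq, Nat.beq_eq] at h
  rw [altCode, MulAut.conjNormal_apply, permCode_mul, permCode_mul, permCode_inv]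
  exact h

theorem hasGeneratingTriple_of_checkEntry {S : Set (alternatingGroup (Fin 5))}
    (hinv : ∀ x ∈ S, x⁻¹ ∈ S) {u v w s i : ℕ} (h : checkEntry (u, v, w, s, i) = true)
    (hS : ∀ c ∈ [u, v, w], ∃ x ∈ S, altCode x = c) : HasGeneratingTriple S := by
  simp only [checkEntry, Bool.and_eq_true, List.all_eq_true, List.any_eq_true, Bool.or_eq_true,
    forceNat_eq, Nat.beq_eq, Nat.blt_eq] at h
  obtain ⟨⟨hs, hi⟩, hT⟩ := h
  have hmem : generatingTriples.getD i [] ∈ generatingTriples := by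
    rw [List.getD_eq_getElem _ _ hi]
    exact List.getElem_mem hi
  generalize generatingTriples.getD i [] = T at hT hmem
  obtain ⟨σ, rfl⟩ := exists_permCode_eq hs
  have key : ∀ j ∈ [0, 2, 4], invCode (T.getD j 0) = T.getD (j + 1) 0 ∧
      ∃ x ∈ S, altCode (MulAut.conjNormal σ x) = T.getD j 0 := by
    intro j hj
    obtain ⟨hTi, c, hc, hcj⟩ := hT j hj
    obtain ⟨x, hx, rfl⟩ := hS c hc
    refine ⟨hTi, ?_⟩
    rcases hcj with h | h
    · exact ⟨x, hx, altCode_conjNormal_of_checkConj h⟩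
    · rw [← altCode_inv] at h
      exact ⟨x⁻¹, hinv x hx, altCode_conjNormal_of_checkConj h⟩
  obtain ⟨k0, x0, hx0, e0⟩ := key 0 (by simp)
  obtain ⟨k2, x2, hx2, e2⟩ := key 2 (by simp)
  obtain ⟨k4, x4, hx4, e4⟩ := key 4 (by simp)
  refine ⟨MulAut.conjNormal σ, T, hmem, ![x0, x2, x4], ?_, ?_⟩
  · intro i
    obtain rfl | rfl | rfl : i = 0 ∨ i = 1 ∨ i = 2 := by fin_cases i <;> simp
    exacts [hx0, hx2, hx4]
  · intro d hd
    interval_cases d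
    · exact e0
    · rw [← k0, ← e0, ← altCode_inv]; rfl
    · exact e2
    · rw [← k2, ← e2, ← altCode_inv]; rfl
    · exact e4
    · rw [← k4, ← e4, ← altCode_inv]; rfl

theorem HasGeneratingTriple.of_image {S : Set (alternatingGroup (Fin 5))}
    (φ : alternatingGroup (Fin 5) ≃* alternatingGroup (Fin 5))
    (h : HasGeneratingTriple (φ '' S)) : HasGeneratingTriple S := by
  obtain ⟨ψ, T, hT, s, hs, hsT⟩ := h
  choose s' hs' hφ using hs
  refine ⟨φ.trans ψ, T, hT, s', hs', ?_⟩
  simpa [hφ] using hsT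

/-- Check that a list of codes is closed under multiplication, and not too long. -/
def checkSubgroup (M : List ℕ) : Bool :=
  memCode M 18056 && Nat.blt M.length 60 &&
    M.all fun x => M.all fun y => forceNat (mulCode x y) (memCode M)

/-- In a finite group the submonoid generated by `S` is already the subgroup. If the codes of `S`
all lay in `M`, so would all 60 codes, but `M` is shorter. -/
theorem exists_not_mem_of_checkSubgroup {S : Set (alternatingGroup (Fin 5))}
    (hS : Subgroup.closure S = ⊤) {M : List ℕ} (hM : checkSubgroup M = true) :
    ∃ x ∈ S, altCode x ∉ M := by
  simp only [checkSubgroup, Bool.and_eq_true, List.all_eq_true, forceNat_eq, Nat.blt_eq,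
    memCode_iff] at hM
  obtain ⟨⟨h1, hlen⟩, hmul⟩ := hM
  by_contra! hcon
  have hall : ∀ x, altCode x ∈ M := by
    intro x
    have hx : x ∈ Submonoid.closure S := by
      rw [← Subgroup.closure_toSubmonoid_of_finite, hS]
      trivial
    induction hx using Submonoid.closure_induction with
    | mem x hx => exact hcon x hx
    | one => exact h1
    | mul x y _ _ hx hy => rw [altCode_mul]; exact hmul _ hx _ hy
  have hle : Fintype.card (alternatingGroup (Fin 5)) ≤ M.toFinset.card :=
    Finset.card_le_card_of_injOn altCode (fun x _ => by simpa using hall x)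
      (altCode_injective.injOn)
  have := natCard_alternatingGroup_five
  rw [Nat.card_eq_fintype_card] at this
  have := M.toFinset_card_le
  omega

/-- Check that `C` contains the first three components of some entry, where the entries are grouped
by their first component. -/
def containsEntry (E : List (ℕ × List (ℕ × ℕ × ℕ × ℕ))) (C : List ℕ) : Bool :=
  E.any fun G => memCode C G.1 && G.2.any fun e => memCode C e.1 && memCode C e.2.1

/-- Check all of the entries in a grouped list. -/
def checkEntries (E : List (ℕ × List (ℕ × ℕ × ℕ × ℕ))) : Bool :=
  E.all fun G => G.2.all fun e => checkEntry (G.1, e)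

/-- Every set of codes from `items` that contains `C` either contains the first three components of
some entry in `E`, or is contained in one of the lists `Ms`. -/
def checkCover (E : List (ℕ × List (ℕ × ℕ × ℕ × ℕ))) (Ms : List (List ℕ)) (items : List ℕ) :
    ℕ → List ℕ → Bool
  | 0, C => containsEntry E C
  | n + 1, C => containsEntry E C || Ms.any fun M => C.all (memCode M) &&
        items.all fun x => memCode M x || checkCover E Ms items n (x :: C)

/-- Soundness of a branching search. As long as the known elements contain no entry, a proper
subgroup `M` is selected; since `S` generates, it has an element outside `M`, and all possibilities
for it, up to inversion, are explored. -/
theorem hasGeneratingTriple_of_checkCover {S : Set (alternatingGroup (Fin 5))}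
    (hinv : ∀ x ∈ S, x⁻¹ ∈ S) (hS : Subgroup.closure S = ⊤)
    {E : List (ℕ × List (ℕ × ℕ × ℕ × ℕ))} (hE : checkEntries E = true)
    {Ms : List (List ℕ)} (hMs : Ms.all checkSubgroup = true) {items : List ℕ}
    (hitems : ∀ x : alternatingGroup (Fin 5), x ≠ 1 → altCode x ∈ items ∨ altCode x⁻¹ ∈ items)
    {n : ℕ} {C : List ℕ} (hC : ∀ c ∈ C, ∃ x ∈ S, altCode x = c)
    (h : checkCover E Ms items n C = true) : HasGeneratingTriple S := by
  have base {C : List ℕ} (hC : ∀ c ∈ C, ∃ x ∈ S, altCode x = c)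
      (h : containsEntry E C = true) : HasGeneratingTriple S := by
    simp only [containsEntry, List.any_eq_true, Bool.and_eq_true, memCode_iff] at h
    obtain ⟨⟨u, G⟩, hG, hu, ⟨v, w, s, i⟩, he, hv, hw⟩ := h
    have hEe := List.all_eq_true.1 (List.all_eq_true.1 hE _ hG) _ he
    refine hasGeneratingTriple_of_checkEntry hinv hEe ?_
    simp only [List.mem_cons, List.not_mem_nil, or_false]
    rintro c (rfl | rfl | rfl)
    exacts [hC _ hu, hC _ hv, hC _ hw]
  induction n generalizing C with
  | zero => exact base hC h
  | succ n ih =>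
    rw [checkCover, Bool.or_eq_true] at h
    rcases h with h | h
    · exact base hC h
    · simp only [List.any_eq_true, Bool.and_eq_true, List.all_eq_true, Bool.or_eq_true,
        memCode_iff] at h
      obtain ⟨M, hM, -, hx⟩ := h
      have hcheck := List.all_eq_true.1 hMs _ hM
      have hM' := hcheck
      simp only [checkSubgroup, Bool.and_eq_true, List.all_eq_true, forceNat_eq, Nat.blt_eq,
        memCode_iff] at hM'
      obtain ⟨y, hy, hyM, hyI⟩ : ∃ y ∈ S, altCode y ∉ M ∧ altCode y ∈ items := by
        obtain ⟨x, hxS, hxM⟩ := exists_not_mem_of_checkSubgroup hS hcheck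
        have hx1 : x ≠ 1 := by
          rintro rfl
          exact hxM hM'.1.1
        rcases hitems x hx1 with hi | hi
        · exact ⟨x, hxS, hxM, hi⟩
        · refine ⟨x⁻¹, hinv x hxS, fun hmem => hxM ?_, hi⟩
          -- A finite set closed under products contains inverses: `x` is a power of `x⁻¹`, so `x⁻¹`
          -- in `M` would put `x` there too.
          have hpow : ∀ k : ℕ, altCode (x⁻¹ ^ k) ∈ M := by
            intro k
            induction k with
            | zero => rw [pow_zero]; exact hM'.1.1
            | succ k ihk => rw [pow_succ, altCode_mul]; exact hM'.2 _ ihk _ hmem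
          have hxpow : x⁻¹ ^ (orderOf x⁻¹ - 1) = x := by
            have h1 : x⁻¹ ^ (orderOf x⁻¹ - 1) * x⁻¹ = 1 := by
              rw [← pow_succ, Nat.sub_add_cancel (orderOf_pos _), pow_orderOf_eq_one]
            simpa using eq_inv_of_mul_eq_one_left h1
          rw [← hxpow]
          exact hpow _
      have hbad := (hx _ hyI).resolve_left hyM
      refine ih (C := altCode y :: C) ?_ hbad
      intro c hc
      rcases List.mem_cons.1 hc with rfl | hc
      · exact ⟨y, hy, rfl⟩
      · exact hC c hc

/-- The maximal subgroups of the alternating group of degree `5`. -/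
def maximalSubgroups : List (List ℕ) :=
  [
    [5344, 5904, 6296, 8984, 9824, 10440, 12960, 13576, 14416, 17104, 17496, 18056],
    [1228, 1802, 2187, 8459, 9740, 10440, 12428, 13576, 14346, 16586, 17419, 18056],
    [16467, 16537, 16586, 16922, 17027, 17104, 17419, 17496, 17601, 17937, 17986, 18056],
    [1620, 1697, 1802, 5666, 5764, 5904, 9740, 9824, 9985, 17937, 17986, 18056],
    [668, 1697, 2187, 4259, 5764, 6296, 12428, 12960, 14465, 16537, 17027, 18056],
    [668, 1123, 4308, 5666, 8459, 10265, 13058, 14416, 17601, 18056],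
    [787, 1228, 4259, 6338, 8284, 9985, 13345, 14416, 16922, 18056],
    [1228, 2138, 5379, 5666, 8417, 8984, 12820, 14465, 16467, 18056],
    [738, 1620, 4259, 5148, 8984, 10307, 12561, 14346, 17601, 18056],
    [1305, 1620, 5344, 6163, 8459, 8900, 12386, 14465, 16922, 18056],
    [668, 2257, 4378, 5344, 8739, 9985, 13380, 14346, 16467, 18056],
    [9985, 10440, 13576, 14465, 17601, 18056], [14346, 14416, 14465, 17937, 17986, 18056],
    [1620, 2187, 12428, 14416, 16467, 18056], [668, 1228, 1620, 17104, 17496, 18056],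
    [4259, 5904, 8459, 9824, 16467, 18056], [5666, 6296, 12960, 14346, 16922, 18056],
    [8459, 8984, 9985, 16537, 17027, 18056], [668, 1802, 8984, 9740, 16922, 18056],
    [1228, 1697, 5344, 5764, 17601, 18056], [4259, 5344, 5666, 16586, 17419, 18056]]

theorem all_checkSubgroup : maximalSubgroups.all checkSubgroup = true := by decide +kernel

/-- The codes of representatives of the nontrivial elements of the alternating group, up to
inverses. -/
def inverseClassCodes : List ℕ :=
  [
    10440, 14416, 17104, 5904, 6296, 8984, 5344, 14465, 17601, 9985, 17937, 2257, 12561, 10265,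
    16537, 1305, 13345, 1697, 8417, 14346, 16586, 1802, 16922, 2138, 4378, 5666, 12386, 738,
    2187, 8459, 16467, 787, 1123, 4259, 1228, 1620, 668]

theorem mem_inverseClassCodes (x : alternatingGroup (Fin 5)) (hx : x ≠ 1) :
    altCode x ∈ inverseClassCodes ∨ altCode x⁻¹ ∈ inverseClassCodes := by
  have key : ∀ g : Equiv.Perm (Fin 5), Equiv.Perm.sign g = 1 → g ≠ 1 →
      (forceNat (permCode g) fun c => memCode inverseClassCodes c ||
        forceNat (invCode c) (memCode inverseClassCodes)) = true := by
    decide +kernel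
  have := key x (Equiv.Perm.mem_alternatingGroup.1 x.2) (by simpa using hx)
  simp only [forceNat_eq, Bool.or_eq_true, memCode_iff, ← permCode_inv] at this
  exact this

/-- One representative for each cycle type: a double transposition, a 3-cycle and a 5-cycle.
Conjugation by odd permutations is allowed, which merges the two classes of 5-cycles. -/
theorem exists_conjNormal (x : alternatingGroup (Fin 5)) (hx : x ≠ 1) :
    ∃ σ : Equiv.Perm (Fin 5), altCode (MulAut.conjNormal σ x) ∈ [14416, 10440, 2257] := by
  have key : ∀ g : Equiv.Perm (Fin 5), Equiv.Perm.sign g = 1 → g ≠ 1 → ∃ σ : Equiv.Perm (Fin 5),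
      (forceNat (permCode g) fun c => forceNat (permCode σ) fun s =>
        [14416, 10440, 2257].any (checkConj s c)) = true := by
    decide +kernel
  obtain ⟨σ, hσ⟩ := key x (Equiv.Perm.mem_alternatingGroup.1 x.2) (by simpa using hx)
  simp only [forceNat_eq, List.any_eq_true] at hσ
  obtain ⟨y, hy, h⟩ := hσ
  exact ⟨σ, altCode_conjNormal_of_checkConj h ▸ hy⟩

/-- Generating sets of two or three elements, given by their codes and grouped by the first one,
with the code of a permutation that conjugates them to a listed triple, and the number of that
triple. They suffice for the generating sets that contain a fixed element of order `2`. -/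
def entriesTwo : List (ℕ × List (ℕ × ℕ × ℕ × ℕ)) :=
  [
    (10440, [
      (14465, 14416, 18056, 8), (17601, 14416, 18056, 9), (10440, 17937, 18056, 1),
      (10440, 13345, 9992, 2), (14346, 14416, 18000, 10), (10440, 16922, 1634, 0),
      (10440, 16467, 738, 0)]),
    (14465, [
      (14465, 17104, 17930, 0), (17601, 14416, 18056, 16), (16922, 14416, 18056, 17),
      (16467, 14416, 17930, 16)]),
    (5904, [
      (5904, 14465, 14346, 0), (5904, 17601, 2250, 0), (9985, 14416, 14472, 12),
      (17937, 14416, 8984, 11), (5904, 10265, 13072, 3), (5904, 13345, 12960, 3),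
      (5904, 14346, 14402, 0), (5904, 16922, 2138, 0), (8459, 14416, 8928, 9),
      (16467, 14416, 8984, 8)]),
    (6296, [
      (14465, 14416, 18056, 10), (6296, 17601, 1802, 0), (6296, 9985, 12554, 0),
      (6296, 17937, 18000, 1), (6296, 10265, 9824, 2), (6296, 13345, 13408, 2),
      (14346, 14416, 18000, 8), (16922, 14416, 18000, 9), (6296, 8459, 13058, 0),
      (6296, 16467, 794, 0)]),
    (8984, [
      (14465, 14416, 18056, 14), (17601, 14416, 18056, 15), (9985, 14416, 17608, 14),
      (8984, 17937, 17608, 0), (8984, 10265, 13576, 4), (8984, 13345, 13576, 5),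
      (14346, 14416, 14416, 14), (16922, 14416, 10328, 14), (16467, 14416, 8984, 14)]),
    (5344, [
      (14465, 14416, 14472, 14), (17601, 14416, 10440, 14), (9985, 14416, 14472, 15),
      (5344, 17937, 10440, 0), (5344, 10265, 9992, 5), (5344, 13345, 9992, 4),
      (14346, 14416, 18000, 14), (16922, 14416, 18000, 15), (5666, 14416, 17496, 14),
      (8459, 14416, 12960, 15), (16467, 14416, 8928, 14)]),
    (9985, [
      (14465, 14416, 14472, 16), (17601, 14416, 8284, 17), (10440, 14416, 14472, 9),
      (9985, 17104, 16586, 0), (17937, 14416, 4252, 9), (9985, 10265, 16586, 4),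
      (14346, 14416, 14416, 17), (16467, 14416, 8984, 18)]),
    (2257, [
      (2257, 14416, 18056, 4)]),
    (12561, [
      (12561, 14416, 14472, 4)]),
    (10265, [
      (10265, 14465, 17937, 4), (10265, 17937, 787, 2), (10265, 10440, 13576, 2),
      (10265, 17104, 5792, 3), (10265, 13345, 18049, 6), (10265, 14346, 14465, 4),
      (10265, 16922, 2138, 4), (10265, 16467, 794, 5)]),
    (16537, [
      (16537, 14416, 18056, 0)]),
    (1305, [
      (1305, 14416, 18056, 5)]),
    (13345, [
      (13345, 14465, 14353, 4), (13345, 17601, 2250, 4), (13345, 17937, 4371, 2),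
      (13345, 17104, 5904, 3), (13345, 14346, 18049, 4), (13345, 16467, 738, 5)]),
    (1697, [
      (1697, 14416, 14472, 0)]),
    (8417, [
      (8417, 14416, 14472, 5)]),
    (16586, [
      (16586, 14416, 18000, 0)]),
    (1802, [
      (1802, 14416, 14416, 0)]),
    (2138, [
      (2138, 14416, 18000, 4)]),
    (4378, [
      (4378, 14416, 14416, 5)]),
    (5666, [
      (14465, 14416, 14472, 17), (9985, 14416, 4308, 15), (17937, 14416, 4308, 9),
      (5666, 13345, 16474, 4), (14346, 14416, 14416, 16), (16922, 14416, 8396, 17),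
      (5666, 10440, 12386, 0), (5666, 17104, 16474, 0), (5904, 14416, 14416, 12),
      (6296, 14416, 14416, 9), (8984, 14416, 14416, 15), (16467, 14416, 8928, 18)]),
    (12386, [
      (12386, 14416, 14416, 4)]),
    (738, [
      (738, 14416, 18000, 5)]),
    (2187, [
      (14465, 14416, 17930, 8), (2187, 17601, 1809, 0), (2187, 9985, 12561, 0),
      (2187, 17937, 17986, 1), (2187, 10265, 14402, 3), (2187, 13345, 17986, 3),
      (14346, 14416, 17986, 8), (2187, 16922, 1697, 0), (2187, 5666, 12449, 0),
      (10440, 14416, 18056, 11), (2187, 17104, 5400, 1), (2187, 5904, 8984, 1),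
      (6296, 14416, 18000, 11), (2187, 8984, 13072, 0), (2187, 5344, 5904, 0),
      (8459, 14416, 9796, 9), (4259, 14416, 9740, 9)]),
    (8459, [
      (14465, 14416, 18056, 18), (9985, 14416, 17601, 18), (8459, 17937, 17601, 0),
      (8459, 13345, 17601, 5), (14346, 14416, 14402, 14), (16922, 14416, 18000, 19),
      (10440, 14416, 8928, 12), (8459, 17104, 17090, 0), (8984, 14416, 13072, 14),
      (16467, 14416, 8928, 16)]),
    (787, [
      (787, 14465, 17930, 5), (787, 17601, 1809, 5), (787, 17937, 794, 3),
      (787, 10265, 13058, 7), (787, 14346, 14402, 5), (787, 5666, 12449, 5),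
      (787, 2187, 10307, 2), (787, 8459, 13058, 4), (787, 16467, 1305, 4),
      (787, 10440, 17608, 3), (787, 17104, 6296, 2), (787, 5904, 17104, 2),
      (787, 6296, 10328, 3), (787, 8984, 17104, 4), (787, 5344, 6352, 5), (787, 1123, 8473, 6),
      (787, 1620, 8417, 4)]),
    (1123, [
      (1123, 14465, 14346, 5), (1123, 9985, 12561, 5), (1123, 17937, 4378, 3),
      (1123, 13345, 5890, 7), (1123, 14346, 17986, 5), (1123, 16922, 1697, 5),
      (1123, 2187, 17475, 2), (1123, 16467, 1249, 4), (1123, 10440, 10440, 3),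
      (1123, 17104, 6352, 2), (1123, 5904, 17048, 2), (1123, 6296, 17496, 3),
      (1123, 8984, 17104, 5), (1123, 5344, 6352, 4), (1123, 4259, 12834, 4),
      (1123, 1228, 5890, 4), (1123, 1620, 8473, 4)]),
    (4259, [
      (14465, 14416, 14346, 14), (17601, 14416, 18056, 19), (4259, 17937, 17433, 0),
      (4259, 10265, 17433, 5), (14346, 14416, 18000, 18), (5666, 14416, 17433, 18),
      (8459, 14416, 5764, 17), (16467, 14416, 8984, 16), (4259, 10440, 12834, 0),
      (4259, 17104, 16922, 0), (5904, 14416, 8984, 9), (6296, 14416, 8984, 12),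
      (8984, 14416, 13072, 15), (5344, 14416, 12960, 14)]),
    (1228, [
      (14465, 14416, 14472, 18), (17601, 14416, 10433, 18), (1228, 17937, 10433, 0),
      (1228, 10265, 10433, 5), (14346, 14416, 17986, 14), (5666, 14416, 14416, 19),
      (2187, 14416, 13380, 9), (8459, 14416, 13380, 15), (16467, 14416, 8928, 17),
      (10440, 14416, 5344, 12), (17104, 14416, 5344, 9), (1228, 5904, 6338, 0),
      (1228, 6296, 5890, 0), (8984, 14416, 5792, 15), (5344, 14416, 5904, 14),
      (1620, 14416, 5344, 16)]),
    (1620, [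
      (14465, 14416, 14346, 16), (17601, 14416, 5400, 18), (9985, 14416, 4322, 14),
      (17937, 14416, 4378, 8), (1620, 10265, 4322, 5), (1620, 13345, 4378, 5),
      (14346, 14416, 14402, 16), (16922, 14416, 5344, 18), (5666, 14416, 4378, 14),
      (8459, 14416, 5344, 17), (4259, 14416, 5400, 17), (1620, 10440, 4322, 0),
      (17104, 14416, 5400, 8), (5904, 14416, 5400, 10), (1620, 6296, 4378, 0),
      (8984, 14416, 5344, 14), (5344, 14416, 5400, 14)]),
    (668, [
      (14465, 14416, 17930, 14), (9985, 14416, 14472, 19), (668, 17937, 10265, 0),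
      (668, 13345, 10265, 5), (14346, 14416, 14416, 18), (16922, 14416, 10265, 18),
      (2187, 14416, 13324, 9), (16467, 14416, 8984, 17), (668, 787, 5666, 4),
      (4259, 14416, 13324, 15), (1228, 14416, 12932, 17), (1620, 14416, 5400, 16),
      (668, 10440, 5666, 0), (17104, 14416, 5400, 9), (668, 5904, 6170, 0),
      (6296, 14416, 5400, 12), (8984, 14416, 5792, 14), (5344, 14416, 5904, 15)]),
    (17104, [
      (17601, 14416, 18056, 12), (17937, 14416, 5400, 11)]),
    (17601, [
      (17937, 14416, 668, 9)]),
    (14346, [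
      (17601, 14416, 18000, 17), (14346, 17104, 17986, 0), (16922, 14416, 18000, 16),
      (16467, 14416, 17986, 16)]),
    (16922, [
      (17601, 14416, 724, 15), (17937, 14416, 724, 9), (17104, 14416, 18000, 12)]),
    (16467, [
      (17601, 14416, 738, 14), (17937, 14416, 794, 8), (16922, 14416, 794, 14),
      (17104, 14416, 8984, 10)])]

/-- The analogue of `entriesTwo` for a fixed element of order `3`. -/
def entriesThree : List (ℕ × List (ℕ × ℕ × ℕ × ℕ)) :=
  [
    (14416, [
      (14465, 10440, 18056, 8), (17601, 10440, 18056, 9), (14416, 16586, 18000, 0)]),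
    (14465, [
      (14465, 17104, 17930, 0), (14465, 16586, 17937, 0)]),
    (5904, [
      (5904, 14465, 14346, 0), (5904, 17601, 2250, 0), (9985, 10440, 16593, 11),
      (5904, 14346, 14402, 0), (5904, 16586, 17048, 1), (8459, 10440, 17601, 11)]),
    (6296, [
      (14465, 10440, 17937, 11), (6296, 17601, 1802, 0), (6296, 9985, 12554, 0),
      (14346, 10440, 18049, 11), (6296, 16586, 17496, 1), (6296, 8459, 13058, 0)]),
    (8984, [
      (14465, 10440, 13576, 9), (17601, 10440, 17608, 9), (9985, 10440, 17608, 8),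
      (14346, 10440, 9824, 12), (8984, 16586, 17104, 0)]),
    (5344, [
      (14465, 10440, 9992, 9), (17601, 10440, 10440, 8), (9985, 10440, 10440, 9),
      (14346, 10440, 13408, 12), (16586, 10440, 10440, 11), (8459, 10440, 12960, 12)]),
    (17937, [
      (17937, 10440, 18056, 1)]),
    (2257, [
      (2257, 10440, 18056, 2)]),
    (12561, [
      (12561, 10440, 14472, 2)]),
    (10265, [
      (10265, 10440, 13576, 2)]),
    (16537, [
      (16537, 10440, 17608, 1)]),
    (1305, [
      (1305, 10440, 17608, 2)]),
    (13345, [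
      (13345, 10440, 9992, 2)]),
    (1697, [
      (1697, 10440, 10440, 1)]),
    (8417, [
      (8417, 10440, 10440, 2)]),
    (14346, [
      (14465, 10440, 18049, 8), (17601, 10440, 18049, 9), (14416, 10440, 18000, 10),
      (14346, 17104, 17986, 0)]),
    (1802, [
      (1802, 14465, 14353, 0), (1802, 17601, 2257, 0), (9985, 10440, 16586, 11),
      (1802, 14416, 14416, 0), (1802, 17104, 6296, 1), (5904, 10440, 14472, 13),
      (1802, 6296, 10328, 1), (8984, 10440, 17608, 11), (1802, 5344, 6352, 0)]),
    (16922, [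
      (16922, 10440, 1634, 0)]),
    (2138, [
      (2138, 10440, 18056, 3)]),
    (4378, [
      (4378, 10440, 13576, 3)]),
    (5666, [
      (5666, 10440, 12386, 0)]),
    (12386, [
      (12386, 10440, 14472, 3)]),
    (738, [
      (738, 10440, 9992, 3)]),
    (2187, [
      (14465, 10440, 17930, 11), (2187, 17601, 1809, 0), (2187, 9985, 12561, 0),
      (14416, 10440, 18056, 11), (2187, 17104, 5400, 1), (2187, 5904, 8984, 1),
      (6296, 10440, 13576, 13), (2187, 8984, 13072, 0), (2187, 5344, 5904, 0)]),
    (8459, [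
      (14465, 10440, 13569, 9), (17601, 10440, 17601, 9), (9985, 10440, 17601, 8),
      (14416, 10440, 8928, 12), (8459, 17104, 17090, 0), (8984, 10440, 17104, 10)]),
    (16467, [
      (16467, 10440, 738, 0)]),
    (787, [
      (787, 10440, 17608, 3)]),
    (1123, [
      (1123, 10440, 10440, 3)]),
    (4259, [
      (4259, 10440, 12834, 0)]),
    (1228, [
      (14465, 10440, 9985, 9), (17601, 10440, 10433, 8), (9985, 10440, 10433, 9),
      (14416, 10440, 5344, 12), (17104, 10440, 10433, 11), (1228, 5904, 6338, 0),
      (1228, 6296, 5890, 0), (8984, 10440, 5792, 12), (5344, 10440, 6352, 10)]),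
    (1620, [
      (1620, 10440, 4322, 0)]),
    (668, [
      (668, 10440, 5666, 0)]),
    (17104, [
      (17601, 10440, 2257, 11)]),
    (16586, [
      (17601, 10440, 2250, 11), (17104, 10440, 18056, 13)]),
    (9985, [
      (14416, 10440, 14472, 9), (9985, 17104, 16586, 0), (14346, 10440, 14465, 9),
      (9985, 16586, 16593, 0)])]

/-- The analogue of `entriesTwo` for a fixed element of order `5`. -/
def entriesFive : List (ℕ × List (ℕ × ℕ × ℕ × ℕ)) :=
  [
    (10440, [
      (10440, 2257, 18056, 2)]),
    (14416, [
      (14416, 2257, 18056, 4)]),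
    (17104, [
      (17104, 2257, 5344, 2)]),
    (5904, [
      (5904, 2257, 8928, 3)]),
    (6296, [
      (6296, 2257, 18000, 3)]),
    (8984, [
      (8984, 2257, 17608, 5)]),
    (14465, [
      (14465, 2257, 14346, 4)]),
    (17601, [
      (17601, 2257, 2257, 4)]),
    (17937, [
      (17937, 2257, 4378, 2)]),
    (12561, [
      (12561, 2257, 18056, 6)]),
    (10265, [
      (10265, 2257, 18056, 7)]),
    (16537, [
      (16537, 2257, 5155, 3)]),
    (1305, [
      (1305, 2257, 10433, 6)]),
    (13345, [
      (13345, 2257, 8739, 6)]),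
    (1697, [
      (1697, 2257, 16467, 2)]),
    (8417, [
      (8417, 2257, 10440, 7)]),
    (16586, [
      (16586, 2257, 5890, 3)]),
    (1802, [
      (1802, 2257, 16523, 3)]),
    (16922, [
      (16922, 2257, 2201, 5)]),
    (2138, [
      (2138, 2257, 5400, 6)]),
    (5666, [
      (5666, 2257, 16474, 5)]),
    (12386, [
      (12386, 2257, 17986, 7)]),
    (738, [
      (738, 2257, 5904, 7)]),
    (2187, [
      (2187, 2257, 14346, 2)]),
    (8459, [
      (8459, 2257, 13569, 5)]),
    (787, [
      (787, 2257, 5344, 7)]),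
    (1123, [
      (1123, 2257, 17475, 6)]),
    (4259, [
      (4259, 2257, 12834, 5)]),
    (1228, [
      (1228, 2257, 9985, 4)]),
    (1620, [
      (1620, 2257, 4378, 4)])]

theorem entriesTwo_all : checkEntries entriesTwo = true := by decide +kernel

theorem entriesThree_all : checkEntries entriesThree = true := by decide +kernel

theorem entriesFive_all : checkEntries entriesFive = true := by decide +kernel

/-- Depth 2 means that at most two elements need to be added to the fixed one. -/
theorem entriesTwo_cover :
    checkCover entriesTwo maximalSubgroups inverseClassCodes 2 [14416] = true := by
  decide +kernel

theorem entriesThree_cover :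
    checkCover entriesThree maximalSubgroups inverseClassCodes 2 [10440] = true := by
  decide +kernel

theorem entriesFive_cover :
    checkCover entriesFive maximalSubgroups inverseClassCodes 2 [2257] = true := by
  decide +kernel

/-- Every set of generators of the alternating group of degree `5` that is closed under inverses
contains one of the listed triples, up to automorphisms. -/
theorem hasGeneratingTriple_of_closure_eq_top {S : Set (alternatingGroup (Fin 5))}
    (hinv : ∀ x ∈ S, x⁻¹ ∈ S) (hS : Subgroup.closure S = ⊤) : HasGeneratingTriple S := by
  obtain ⟨x, hxS, hx⟩ : ∃ x ∈ S, x ≠ 1 := by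
    by_contra! hcon
    have : Subgroup.closure S ≤ ⊥ := (Subgroup.closure_le _).2 fun x hx => by simp [hcon x hx]
    rw [hS, top_le_iff] at this
    exact bot_ne_top this
  obtain ⟨σ, hσ⟩ := exists_conjNormal x hx
  refine HasGeneratingTriple.of_image (MulAut.conjNormal σ) ?_
  have hinv' : ∀ y ∈ (MulAut.conjNormal σ : alternatingGroup (Fin 5) ≃* _) '' S,
      y⁻¹ ∈ (MulAut.conjNormal σ : alternatingGroup (Fin 5) ≃* _) '' S := by
    rintro _ ⟨y, hy, rfl⟩
    exact ⟨y⁻¹, hinv y hy, map_inv _ _⟩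
  have hS' : Subgroup.closure ((MulAut.conjNormal σ : alternatingGroup (Fin 5) ≃* _) '' S) = ⊤ := by
    have := MonoidHom.map_closure (MulAut.conjNormal σ : alternatingGroup (Fin 5) ≃*
      alternatingGroup (Fin 5)).toMonoidHom S
    rw [hS, Subgroup.map_top_of_surjective _ (MulEquiv.surjective _)] at this
    exact this.symm
  have hC {r : ℕ} (hr : altCode (MulAut.conjNormal σ x) = r) : ∀ c ∈ [r],
      ∃ y ∈ (MulAut.conjNormal σ : alternatingGroup (Fin 5) ≃* _) '' S, altCode y = c := by
    intro c hc
    obtain rfl := List.mem_singleton.1 hc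
    exact ⟨_, ⟨x, hxS, rfl⟩, hr⟩
  simp only [List.mem_cons, List.not_mem_nil, or_false] at hσ
  rcases hσ with hσ | hσ | hσ
  · exact hasGeneratingTriple_of_checkCover hinv' hS' entriesTwo_all all_checkSubgroup
      mem_inverseClassCodes (hC hσ) entriesTwo_cover
  · exact hasGeneratingTriple_of_checkCover hinv' hS' entriesThree_all all_checkSubgroup
      mem_inverseClassCodes (hC hσ) entriesThree_cover
  · exact hasGeneratingTriple_of_checkCover hinv' hS' entriesFive_all all_checkSubgroup
      mem_inverseClassCodes (hC hσ) entriesFive_cover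

/-! ### Hamiltonian cycles in the products -/

/-- Check the three words of a certificate. -/
def checkCertificate : List ℕ × ℕ × ℕ × ℕ → Bool
  | (T, u, v, w) => checkWalk (T.getD · 0) (lowDigits 6 u 0 60) 18056 [] &&
      checkWalk (T.getD · 0) (lowDigits 6 v 0 60) 18056 [] &&
      checkWalk (T.getD · 0) (lowDigits 6 w 0 60) 18056 [] &&
      decide (exponentDet (lowDigits 6 u 0 60) (lowDigits 6 v 0 60) (lowDigits 6 w 0 60) ≠ 0) &&
      decide ((exponentDet (lowDigits 6 u 0 60) (lowDigits 6 v 0 60)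
        (lowDigits 6 w 0 60)).natAbs < 10000)

theorem all_checkCertificate : certificates.all checkCertificate = true := by decide +kernel

/-- The hamiltonian word of the exceptional triple, in base `6`. -/
def exceptionalWord : List ℕ := lowDigits 6 4766375354082220069208858022779431348183317830 0 60

theorem checkWalk_exceptionalWord :
    checkWalk (exceptionalTriple.getD · 0) exceptionalWord 18056 [] = true := by decide +kernel

/-- This word detects a nontrivial lift of the involution, but not one of the element of order 3. -/
theorem exponentSum_exceptionalWord : exponentSum 0 exceptionalWord = 20 ∧
    exponentSum 1 exceptionalWord = 0 ∧ exponentSum 2 exceptionalWord = 0 := by decide +kernel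

/-- The third letter, which repeats the second one in `A`, is avoided; so its lift never matters. -/
theorem lt_four_of_mem_exceptionalWord : ∀ d ∈ exceptionalWord, d < 4 := by decide +kernel

theorem closure_eq_top_of_connected {G : Type*} [Group G] {S : Set G}
    (h : (SimpleGraph.mulCayley S).Connected) : Subgroup.closure S = ⊤ := by
  have key : ∀ {u v : G}, (SimpleGraph.mulCayley S).Walk u v → u⁻¹ * v ∈ Subgroup.closure S := by
    intro u v c
    induction c with
    | nil => simp
    | cons hadj _ ih =>
      rename_i u v w _
      rw [show u⁻¹ * w = (u⁻¹ * v) * (v⁻¹ * w) by group]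
      refine Subgroup.mul_mem _ ?_ ih
      rw [SimpleGraph.mulCayley_adj] at hadj
      rcases hadj.2 with h | h
      · exact Subgroup.subset_closure h
      · simpa using Subgroup.inv_mem _ (Subgroup.subset_closure h)
  rw [eq_top_iff]
  intro g _
  obtain ⟨c⟩ := h.preconnected 1 g
  simpa using key c

theorem not_comm_alternatingGroup_five :
    ¬ ∀ x y : alternatingGroup (Fin 5), x * y = y * x := by
  intro h
  have key : ∃ g h : Equiv.Perm (Fin 5), Equiv.Perm.sign g = 1 ∧ Equiv.Perm.sign h = 1 ∧
      g * h ≠ h * g :=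
    ⟨Equiv.swap 0 1 * Equiv.swap 1 2, Equiv.swap 0 1 * Equiv.swap 1 3, by decide, by decide,
      by decide⟩
  obtain ⟨x, y, hx, hy, hxy⟩ := key
  exact hxy (congrArg Subtype.val (h ⟨x, Equiv.Perm.mem_alternatingGroup.2 hx⟩
    ⟨y, Equiv.Perm.mem_alternatingGroup.2 hy⟩))

theorem evalLetter_mem {G : Type*} [Group G] {S : Set G} {l : Fin 3 → G}
    (hl : ∀ i, l i ∈ S ∨ (l i)⁻¹ ∈ S) (d : ℕ) : evalLetter l d ∈ S ∨ (evalLetter l d)⁻¹ ∈ S := by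
  unfold evalLetter
  split_ifs
  · exact hl _
  · rw [inv_inv]
    exact (hl _).symm

theorem natCard_multiplicative_zmod {p : ℕ} : Nat.card (Multiplicative (ZMod p)) = p := by
  rw [Nat.card_congr Multiplicative.toAdd, Nat.card_zmod]

theorem three_le_natCard_prod {A : Type*} [Group A] {p : ℕ} [Finite A] (hp : 3 ≤ p) :
    3 ≤ Nat.card (A × Multiplicative (ZMod p)) := by
  rw [Nat.card_prod, natCard_multiplicative_zmod]
  exact hp.trans (Nat.le_mul_of_pos_left p Nat.card_pos)

section Lifts

variable {A : Type*} [Group A] {p : ℕ} [Fact p.Prime] {S : Set (A × Multiplicative (ZMod p))}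
  {l : Fin 3 → A × Multiplicative (ZMod p)} {w : List ℕ}

instance : Finite (Multiplicative (ZMod p)) :=
  Nat.finite_of_card_ne_zero (by
    rw [natCard_multiplicative_zmod]; exact (Fact.out : p.Prime).ne_zero)

theorem hasHamiltonianCycle_of_prod_ne_one [Finite A] (hp : 3 ≤ p)
    (hl : ∀ i, l i ∈ S ∨ (l i)⁻¹ ∈ S)
    (hw : IsHamiltonianWord (w.map (evalLetter fun i => (l i).1)))
    (hv : (w.map (evalLetter fun i => (l i).2)).prod ≠ 1) :
    HasHamiltonianCycle (SimpleGraph.mulCayley S) := by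
  have hfst : (w.map (evalLetter l)).map Prod.fst = w.map (evalLetter fun i => (l i).1) := by
    rw [List.map_map]
    exact List.map_congr_left fun d _ => map_evalLetter (MonoidHom.fst _ _) l d
  have hsnd : (w.map (evalLetter l)).prod.2 = (w.map (evalLetter fun i => (l i).2)).prod := by
    rw [← MonoidHom.coe_snd, ← List.prod_hom, List.map_map]
    exact congrArg List.prod (List.map_congr_left fun d _ => map_evalLetter (MonoidHom.snd _ _) l d)
  have hW : IsHamiltonianWord (List.replicate p (w.map (evalLetter l))).flatten :=
    IsHamiltonianWord.of_fst natCard_multiplicative_zmod (hfst ▸ hw) (hsnd ▸ hv)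
  refine hW.hasHamiltonianCycle (three_le_natCard_prod hp) fun x hx => ?_
  obtain ⟨W, hWmem, hx⟩ := List.mem_flatten.1 hx
  obtain rfl := (List.mem_replicate.1 hWmem).2
  obtain ⟨d, -, rfl⟩ := List.mem_map.1 hx
  exact evalLetter_mem hl d

/-- All letters of the word lie in `A × 1`, whereas `S` generates the product and so has an element
outside; that element connects the layers. -/
theorem hasHamiltonianCycle_of_forall_eq_one [Finite A] [IsSimpleGroup A]
    (hA : ¬ ∀ x y : A, x * y = y * x) (hp : 3 ≤ p) (hAp : Nat.card A ≤ p)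
    (hS : Subgroup.closure S = ⊤) (hl : ∀ i, l i ∈ S ∨ (l i)⁻¹ ∈ S)
    (hw : IsHamiltonianWord (w.map (evalLetter fun i => (l i).1)))
    (hv : ∀ d ∈ w, evalLetter (fun i => (l i).2) d = 1) :
    HasHamiltonianCycle (SimpleGraph.mulCayley S) := by
  obtain ⟨⟨a, c⟩, hac, hc⟩ : ∃ x ∈ S, x.2 ≠ 1 := by
    by_contra! hcon
    have hle : Subgroup.closure S ≤ (MonoidHom.snd A (Multiplicative (ZMod p))).ker :=
      (Subgroup.closure_le _).2 hcon
    rw [hS] at hle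
    have h1 : Multiplicative.ofAdd (1 : ZMod p) = 1 :=
      hle (Subgroup.mem_top ((1 : A), Multiplicative.ofAdd (1 : ZMod p)))
    exact one_ne_zero (Multiplicative.ofAdd.injective h1)
  have hpair (d : ℕ) (hd : d ∈ w) : evalLetter l d = (evalLetter (fun i => (l i).1) d, 1) := by
    ext1
    · exact map_evalLetter (MonoidHom.fst _ _) l d
    · exact (map_evalLetter (MonoidHom.snd _ _) l d).trans (hv d hd)
  obtain ⟨W, hW, hWS⟩ :=
    exists_hamiltonianWord_of_layers hA natCard_multiplicative_zmod hAp hw a hc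
  refine hW.hasHamiltonianCycle (three_le_natCard_prod hp) fun x hx => ?_
  rcases hWS x hx with rfl | ⟨y, rfl, hy | hy⟩
  · exact Or.inl hac
  · obtain ⟨d, hd, rfl⟩ := List.mem_map.1 hy
    rw [← hpair d hd]
    exact evalLetter_mem hl d
  · obtain ⟨d, hd, hdy⟩ := List.mem_map.1 hy
    obtain rfl : y = (evalLetter (fun i => (l i).1) d)⁻¹ := by rw [hdy, inv_inv]
    have := evalLetter_mem hl d
    rw [hpair d hd] at this
    simpa [or_comm] using this

end Lifts

/-- Every connected Cayley graph on the product of the alternating group of degree `5` and a group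
of large prime order congruent to `1` modulo `3` has a hamiltonian cycle. -/
theorem connectedCayleyGraphsHamiltonian_prod {p : ℕ} [Fact p.Prime] (hp3 : p ≡ 1 [MOD 3])
    (hp : 10000 < p) :
    ConnectedCayleyGraphsHamiltonian (alternatingGroup (Fin 5) × Multiplicative (ZMod p)) := by
  intro S hconn
  have hS := closure_eq_top_of_connected hconn
  have hAp : Nat.card (alternatingGroup (Fin 5)) ≤ p := by
    rw [natCard_alternatingGroup_five]; omega
  set F : Set (alternatingGroup (Fin 5)) := {y | ∃ x, (x ∈ S ∨ x⁻¹ ∈ S) ∧ x.1 = y} with hF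
  have hFinv : ∀ y ∈ F, y⁻¹ ∈ F := by
    rintro _ ⟨x, hx, rfl⟩
    exact ⟨x⁻¹, by simpa [or_comm] using hx, rfl⟩
  have hFtop : Subgroup.closure F = ⊤ := by
    have := MonoidHom.map_closure (MonoidHom.fst (alternatingGroup (Fin 5))
      (Multiplicative (ZMod p))) S
    rw [hS, Subgroup.map_top_of_surjective _ Prod.fst_surjective] at this
    rw [eq_top_iff, this]
    refine Subgroup.closure_mono ?_
    rintro _ ⟨x, hx, rfl⟩
    exact ⟨x, Or.inl hx, rfl⟩
  obtain ⟨φ, T, hT, s, hs, hsT⟩ := hasGeneratingTriple_of_closure_eq_top hFinv hFtop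
  -- Repeated entries of a triple are lifted independently, which is why exponent sums treat them as
  -- separate letters.
  choose l hl hls using hs
  obtain rfl : (fun i => (l i).1) = s := funext hls
  have word {w : ℕ} (hw : checkWalk (T.getD · 0) (lowDigits 6 w 0 60) 18056 [] = true) :
      IsHamiltonianWord ((lowDigits 6 w 0 60).map (evalLetter fun i => (l i).1)) := by
    have := (isHamiltonianWord_of_checkWalk hsT hw).map φ.symm
    rw [List.map_map] at this
    convert this using 2
    funext d
    have := map_evalLetter φ.symm.toMonoidHom (fun i => φ (l i).1) d
    simpa using this.symm
  rcases List.mem_cons.1 hT with rfl | hT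
  · have hw : IsHamiltonianWord (exceptionalWord.map (evalLetter fun i => (l i).1)) :=
      word checkWalk_exceptionalWord
    obtain ⟨h0, h1, h2⟩ := exponentSum_exceptionalWord
    by_cases hz0 : (l 0).2 = 1
    · by_cases hz1 : (l 1).2 = 1
      · refine hasHamiltonianCycle_of_forall_eq_one not_comm_alternatingGroup_five (by omega) hAp
          hS hl hw fun d hd => ?_
        have := lt_four_of_mem_exceptionalWord d hd
        interval_cases d
        exacts [hz0, inv_eq_one.2 hz0, hz1, inv_eq_one.2 hz1]
      -- Only here does the congruence of `p` modulo 3 matter.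
      · obtain ⟨m, hm⟩ : ∃ m, p = 4 + 3 * m := by
          have : p % 3 = 1 := hp3
          exact ⟨(p - 4) / 3, by omega⟩
        obtain ⟨W, hW, hWS⟩ := StrandStep.exists_hamiltonianWord natCard_multiplicative_zmod hm hz1
          (a := φ (l 0).1) (b := φ (l 1).1) (hsT 0 (by norm_num)) (hsT 2 (by norm_num)) (hsT 3 (by norm_num))
        -- The word was found for the images under `φ`; `φ.symm` on the first factor brings it back
        -- to `S`.
        refine (hW.map (MulEquiv.prodCongr φ.symm (MulEquiv.refl _))).hasHamiltonianCycle
          (three_le_natCard_prod (by omega)) fun x hx => ?_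
        obtain ⟨y, hy, rfl⟩ := List.mem_map.1 hx
        have e0 : (MulEquiv.prodCongr φ.symm (MulEquiv.refl (Multiplicative (ZMod p))))
            (φ (l 0).1, 1) = l 0 := by
          exact Prod.ext (φ.symm_apply_apply _) hz0.symm
        have e1 : (MulEquiv.prodCongr φ.symm (MulEquiv.refl (Multiplicative (ZMod p))))
            (φ (l 1).1, (l 1).2) = l 1 := by
          exact Prod.ext (φ.symm_apply_apply _) rfl
        rcases hWS y hy with rfl | rfl | rfl
        · rw [e0]; exact hl 0
        · rw [e1]; exact hl 1
        · rw [map_inv, e1, inv_inv]; exact (hl 1).symm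
    · refine hasHamiltonianCycle_of_prod_ne_one (by omega) hl hw fun h => hz0 ?_
      have := toAdd_prod_evalLetter (fun i => (l i).2) exceptionalWord
      rw [h, h0, h1, h2] at this
      simp only [toAdd_one, Int.cast_zero, zero_mul, add_zero] at this
      -- The exponent sum 20 of the involution is invertible modulo `p`.
      have h20 : ((20 : ℤ) : ZMod p) ≠ 0 := by
        rw [Ne, ZMod.intCast_zmod_eq_zero_iff_dvd, Int.natCast_dvd]
        exact Nat.not_dvd_of_pos_of_lt (by norm_num) (by norm_num; omega)
      exact Multiplicative.toAdd.injective ((mul_eq_zero.1 this.symm).resolve_left h20)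
  · obtain ⟨⟨T, u, v, w⟩, hcert, rfl⟩ := List.mem_map.1 hT
    have hcheck := List.all_eq_true.1 all_checkCertificate _ hcert
    simp only [checkCertificate, Bool.and_eq_true, decide_eq_true_eq] at hcheck
    obtain ⟨⟨⟨⟨hu, hv⟩, hw⟩, hdet⟩, hlt⟩ := hcheck
    by_cases hz : ∃ i, (l i).2 ≠ 1
    · obtain ⟨x, hx, hne⟩ := exists_prod_ne_one hdet (by omega) hz
      have hxw : IsHamiltonianWord (x.map (evalLetter fun i => (l i).1)) := by
        simp only [List.mem_cons, List.not_mem_nil, or_false] at hx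
        rcases hx with rfl | rfl | rfl
        exacts [word hu, word hv, word hw]
      exact hasHamiltonianCycle_of_prod_ne_one (by omega) hl hxw hne
    · push Not at hz
      exact hasHamiltonianCycle_of_forall_eq_one not_comm_alternatingGroup_five (by omega) hAp
        hS hl (word hu) fun d _ => by simp [evalLetter, hz]

theorem mainTheorem2 :
    ∃ (G : ℕ → Type) (_ : ∀ n, Group (G n)),
      (∀ n, Finite (G n)) ∧
      (∀ m n, m ≠ n → IsEmpty (G m ≃* G n)) ∧
      ∀ n, ConnectedCayleyGraphsHamiltonian (G n) ∧ ¬ Group.IsSolvable (G n) := by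
  have hinf : {p : ℕ | p.Prime ∧ p ≡ 1 [MOD 3] ∧ 10000 < p}.Infinite := by
    rw [Set.infinite_iff_exists_gt]
    intro a
    -- The case of Dirichlet's theorem for primes congruent to 1.
    obtain ⟨p, hp, hlt, hmod⟩ := Nat.exists_prime_gt_modEq_one (k := 3) (a + 10000) (by norm_num)
    exact ⟨p, ⟨hp, hmod, by omega⟩, by omega⟩
  set f := hinf.natEmbedding with hf
  have hprime (n : ℕ) : Fact (f n : ℕ).Prime := ⟨(f n).2.1⟩
  refine ⟨fun n => alternatingGroup (Fin 5) × Multiplicative (ZMod (f n)), fun n => inferInstance,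
    fun n => inferInstance, fun m n hmn => ⟨fun e => hmn ?_⟩, fun n => ⟨?_, fun h => ?_⟩⟩
  · have := Nat.card_congr e.toEquiv
    rw [Nat.card_prod, Nat.card_prod, natCard_multiplicative_zmod, natCard_multiplicative_zmod,
      natCard_alternatingGroup_five] at this
    exact f.injective (Subtype.ext (by omega))
  · exact connectedCayleyGraphsHamiltonian_prod (f n).2.2.1 (f n).2.2.2
  · have : Group.IsSolvable (alternatingGroup (Fin 5)) :=
      Group.isSolvable_of_surjective (f := MonoidHom.fst (alternatingGroup (Fin 5))
        (Multiplicative (ZMod (f n)))) Prod.fst_surjective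
    exact not_comm_alternatingGroup_five (IsSimpleGroup.comm_iff_isSolvable.2 this)
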